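/- A \emph{tiling} of the Euclidean plane is a collection $\mathcal T$ of sets (tiles) whose union is the plane and such that different tiles have disjoint interiors. A convex $n$-gon ($n\ge 3$) is the convex hull of $n$ points (its corners), none of which lies in the convex hull of the others. In a tiling by convex polygons (whose numbers of corners may differ from tile to tile), a \emph{vertex} is a point at which corners of two or more tiles meet, its \emph{valence} is the number of tiles containing it, an \emph{edge} is an intersection of two different tiles that is a nondegenerate segment, and two different tiles are \emph{adjacent} (each is an adjacent of the other) if they have an edge in common. A tiling is \emph{normal} if every tile is a topological disk, the intersection of any two tiles is connected (possibly empty), and there are $u,U>0$ such that every tile contains a disk of radius $u$ and is contained in a disk of radius $U$. For $r>0$ and a point $M$ let $D(r,M)$ be the closed disk of radius $r$ centred at $M$, and let the patch $A(r,M)$ consist of the tiles contained in $D(r,M)$, the tiles that meet the boundary of $D(r,M)$ but are not contained in $D(r,M)$, and the tiles surrounded by the latter (those whose interior lies in a bounded connected component of the complement of their union). Let $t(r,M)$, $t_h(r,M)$, $v_j(r,M)$ be the numbers of tiles, of tiles with exactly $h$ adjacents, and of $j$-valent vertices in $A(r,M)$. A tiling is \emph{strongly balanced} if it is normal and all the limits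 $$t_h(\mathcal T)=\lim_{r\to\infty}\frac{t_h(r,M)}{t(r,M)},\qquad v_j(\mathcal T)=\lim_{r\to\infty}\frac{v_j(r,M)}{t(r,M)}$$ exist, for every $M$. A tiling is \emph{periodic} if it coincides with its translate by some nonzero vector. (1) Let $\mathcal T$ be a strongly balanced tiling by convex polygons (in particular, by convex $n$-gons for some fixed $n$). Then, with the limits taken about any centre $M$, the series $\sum_{h\ge 3} h\, t_h(\mathcal T)$ converges and $$\sum_{h\ge 3} h\, t_h(\mathcal T)\le 6 .$$ (2) If $P$ is a convex $n$-gon and there is a periodic tiling of the plane all of whose tiles are congruent to $P$ (reflections allowed), then $n\le 6$. -/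

import Mathlib

open Filter Topology

noncomputable section

namespace PlaneTiling

/-- The Euclidean plane. -/
abbrev Plane : Type := EuclideanSpace ℝ (Fin 2)

/-- A collection of sets (the tiles) is a tiling of the plane if the tiles cover the plane and
different tiles have disjoint interiors. -/
def IsTiling (𝒯 : Set (Set Plane)) : Prop :=
  ⋃₀ 𝒯 = Set.univ ∧
    ∀ S ∈ 𝒯, ∀ T ∈ 𝒯, S ≠ T → Disjoint (interior S) (interior T)

/-- `P` is a convex `n`-gon (as a closed region): the convex hull of `n ≥ 3` points, none of which
lies in the convex hull of the others. These points are the corners of `P`. -/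
def IsConvexNGon (n : ℕ) (P : Set Plane) : Prop :=
  3 ≤ n ∧ ∃ c : Fin n → Plane, ConvexIndependent ℝ c ∧ P = convexHull ℝ (Set.range c)

/-- `P` is a convex polygon. -/
def IsConvexPolygon (P : Set Plane) : Prop :=
  ∃ n : ℕ, IsConvexNGon n P

/-- `p` is a corner of the convex polygon `T`. -/
def IsCorner (T : Set Plane) (p : Plane) : Prop :=
  p ∈ Set.extremePoints ℝ T

/-- `p` is a vertex of the tiling `𝒯` (by convex polygons): corners of two or more tiles meet
at `p`. -/
def IsVertex (𝒯 : Set (Set Plane)) (p : Plane) : Prop :=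
  ∃ S ∈ 𝒯, ∃ T ∈ 𝒯, S ≠ T ∧ IsCorner S p ∧ IsCorner T p

/-- The valence of `p`: the number of tiles that meet at `p` (a tile having `p` in the relative
interior of a side is counted). -/
def valence (𝒯 : Set (Set Plane)) (p : Plane) : ℕ∞ :=
  {T : Set Plane | T ∈ 𝒯 ∧ p ∈ T}.encard

/-- `E` is an edge of the tiling `𝒯` (by convex polygons): the intersection of two different
tiles, when it is a nondegenerate line segment. -/
def IsEdge (𝒯 : Set (Set Plane)) (E : Set Plane) : Prop :=
  ∃ S ∈ 𝒯, ∃ T ∈ 𝒯, S ≠ T ∧ E = S ∩ T ∧ ∃ a b : Plane, a ≠ b ∧ E = segment ℝ a b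

/-- Two different tiles are adjacent if they have an edge in common. -/
def Adjacent (𝒯 : Set (Set Plane)) (S T : Set Plane) : Prop :=
  S ∈ 𝒯 ∧ T ∈ 𝒯 ∧ S ≠ T ∧ ∃ E, IsEdge 𝒯 E ∧ E ⊆ S ∧ E ⊆ T

/-- The number of adjacents of the tile `T`. -/
def numAdjacents (𝒯 : Set (Set Plane)) (T : Set Plane) : ℕ∞ :=
  {S : Set Plane | Adjacent 𝒯 T S}.encard

/-- The tiles are uniformly bounded: each contains a disk of radius `u` and is contained in a disk
of radius `U`, for some fixed `u, U > 0`. -/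
def UniformlyBounded (𝒯 : Set (Set Plane)) : Prop :=
  ∃ u U : ℝ, 0 < u ∧ 0 < U ∧ ∀ T ∈ 𝒯,
    (∃ x : Plane, Metric.closedBall x u ⊆ T) ∧ (∃ y : Plane, T ⊆ Metric.closedBall y U)

/-- A tiling is normal if its tiles are topological disks, any two tiles have a connected
(possibly empty) intersection, and the tiles are uniformly bounded. -/
def IsNormal (𝒯 : Set (Set Plane)) : Prop :=
  (∀ T ∈ 𝒯, Nonempty (T ≃ₜ Metric.closedBall (0 : Plane) 1)) ∧
  (∀ S ∈ 𝒯, ∀ T ∈ 𝒯, S ≠ T → IsPreconnected (S ∩ T)) ∧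
  UniformlyBounded 𝒯

/-- The tiles contained in the closed disk of radius `r` centred at `M`. -/
def innerTiles (𝒯 : Set (Set Plane)) (r : ℝ) (M : Plane) : Set (Set Plane) :=
  {T | T ∈ 𝒯 ∧ T ⊆ Metric.closedBall M r}

/-- The tiles that meet the boundary of the closed disk but are not contained in the disk. -/
def boundaryTiles (𝒯 : Set (Set Plane)) (r : ℝ) (M : Plane) : Set (Set Plane) :=
  {T | T ∈ 𝒯 ∧ (T ∩ Metric.sphere M r).Nonempty ∧ ¬ T ⊆ Metric.closedBall M r}

/-- The tiles surrounded by the boundary tiles but not belonging to them: the interior of the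
tile lies in a bounded connected component of the complement of the union of the boundary
tiles. -/
def surroundedTiles (𝒯 : Set (Set Plane)) (r : ℝ) (M : Plane) : Set (Set Plane) :=
  {T | T ∈ 𝒯 ∧ T ∉ boundaryTiles 𝒯 r M ∧
    ∃ x ∈ (⋃₀ boundaryTiles 𝒯 r M)ᶜ,
      Bornology.IsBounded (connectedComponentIn (⋃₀ boundaryTiles 𝒯 r M)ᶜ x) ∧
      interior T ⊆ connectedComponentIn (⋃₀ boundaryTiles 𝒯 r M)ᶜ x}

/-- The patch `A(r, M)` of tiles generated by the closed disk of radius `r` centred at `M`. -/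
def patch (𝒯 : Set (Set Plane)) (r : ℝ) (M : Plane) : Set (Set Plane) :=
  innerTiles 𝒯 r M ∪ boundaryTiles 𝒯 r M ∪ surroundedTiles 𝒯 r M

/-- `t(r, M)`: the number of tiles in the patch. -/
def tileCount (𝒯 : Set (Set Plane)) (r : ℝ) (M : Plane) : ℕ :=
  (patch 𝒯 r M).ncard

/-- `t_h(r, M)`: the number of tiles with `h` adjacents in the patch. -/
def tileCountWith (𝒯 : Set (Set Plane)) (h : ℕ) (r : ℝ) (M : Plane) : ℕ :=
  {T : Set Plane | T ∈ patch 𝒯 r M ∧ numAdjacents 𝒯 T = h}.ncard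

/-- `v_j(r, M)`: the number of `j`-valent vertices in the patch. -/
def vertexCountWith (𝒯 : Set (Set Plane)) (j : ℕ) (r : ℝ) (M : Plane) : ℕ :=
  {p : Plane | p ∈ ⋃₀ patch 𝒯 r M ∧ IsVertex 𝒯 p ∧ valence 𝒯 p = j}.ncard

/-- `τ` is the limit `t_h(𝒯)` of `t_h(r, M) / t(r, M)` as `r → ∞`, taken with centre `M`. -/
def IsTileDensity (𝒯 : Set (Set Plane)) (M : Plane) (h : ℕ) (τ : ℝ) : Prop :=
  Tendsto (fun r : ℝ => (tileCountWith 𝒯 h r M : ℝ) / (tileCount 𝒯 r M : ℝ)) atTop (𝓝 τ)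

/-- `ν` is the limit `v_j(𝒯)` of `v_j(r, M) / t(r, M)` as `r → ∞`, taken with centre `M`. -/
def IsVertexDensity (𝒯 : Set (Set Plane)) (M : Plane) (j : ℕ) (ν : ℝ) : Prop :=
  Tendsto (fun r : ℝ => (vertexCountWith 𝒯 j r M : ℝ) / (tileCount 𝒯 r M : ℝ)) atTop (𝓝 ν)

/-- A tiling is strongly balanced if it is normal and all the limits `t_h(𝒯)` and `v_j(𝒯)`
exist, for any centre `M`. -/
def IsStronglyBalanced (𝒯 : Set (Set Plane)) : Prop :=
  IsNormal 𝒯 ∧ ∀ M : Plane,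
    (∀ h : ℕ, ∃ τ : ℝ, IsTileDensity 𝒯 M h τ) ∧ (∀ j : ℕ, ∃ ν : ℝ, IsVertexDensity 𝒯 M j ν)

/-- `T` has the same size and shape as `P` (reflections are allowed). -/
def IsCongruentTo (P T : Set Plane) : Prop :=
  ∃ g : Plane ≃ᵢ Plane, T = g '' P

/-- A tiling is periodic if it coincides with its translate by some nonzero vector. -/
def IsPeriodic (𝒯 : Set (Set Plane)) : Prop :=
  ∃ v : Plane, v ≠ 0 ∧ (fun T : Set Plane => (fun x : Plane => x + v) '' T) '' 𝒯 = 𝒯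

end PlaneTiling

end

noncomputable section

namespace PlaneTiling

open MeasureTheory Metric Set

/-! The proof counts angles. The angle of a tile at a point is the area of a sector of the unit
disk, so a full turn is ω = `diskArea`. A node of a tile is a point of it where at least three tiles
meet. Every corner is a node, and at a node that is not a corner the angle is ω/2; since exterior
angles add up to ω, the sum of ω/2 - angle over the nodes of a tile is ω (`sum_nodes`). For a tile
with k nodes, the sum of ω/3 - angle is therefore ω - kω/6. Grouped by points instead, the m ≥ 3
tiles at a node contribute mω/3 - ω ≥ 0. So a finite set of tiles has at most six nodes per tile on
average, up to an error from the tiles at its rim (`sum_ncard_nodes_le`). By area, a patch of radius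
r has O(r) rim tiles and at least r²/U² tiles, so the error disappears as r → ∞.

A tile has at most as many adjacents as nodes (`numAdjacents_le`): going around the tile with its
interior on the left, each edge starts at a node, and different adjacents give different starting
nodes. This yields (1), where only finitely many terms are nonzero because the number of nodes of a
tile is uniformly bounded. For (2), the n corners of each tile are nodes, so n ≥ 7 would contradict
the average on a large patch. -/

/-- Rotation of the plane by a quarter turn. -/
def quarterTurn : Plane ≃ₗᵢ[ℝ] Plane where
  toFun x := !₂[-x 1, x 0]
  invFun x := !₂[x 1, -x 0]
  map_add' x y := by ext i; fin_cases i <;> simp; ring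
  map_smul' c x := by ext i; fin_cases i <;> simp
  left_inv x := by ext i; fin_cases i <;> simp
  right_inv x := by ext i; fin_cases i <;> simp
  norm_map' x := by
    simp [EuclideanSpace.norm_eq, Fin.sum_univ_two, add_comm]

@[simp] lemma quarterTurn_zero (x : Plane) : quarterTurn x 0 = -x 1 := rfl

@[simp] lemma quarterTurn_one (x : Plane) : quarterTurn x 1 = x 0 := rfl

lemma inner_eq (x y : Plane) : inner ℝ x y = x 0 * y 0 + x 1 * y 1 := by
  simp [PiLp.inner_apply, Fin.sum_univ_two, mul_comm]

lemma quarterTurn_quarterTurn (x : Plane) : quarterTurn (quarterTurn x) = -x := by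
  ext i; fin_cases i <;> simp

lemma exists_smul_eq_of_inner_quarterTurn_eq_zero {u v : Plane} (hu : u ≠ 0)
    (h : inner ℝ (quarterTurn u) v = 0) : ∃ k : ℝ, v = k • u := by
  rw [inner_eq] at h
  simp only [quarterTurn_zero, quarterTurn_one] at h
  by_cases h0 : u 0 = 0
  · have h1 : u 1 ≠ 0 := by
      intro h1; apply hu; ext i; fin_cases i <;> simp [h0, h1]
    refine ⟨v 1 / u 1, ?_⟩
    ext i; fin_cases i
    · simp [h0]; simpa [h0, h1] using h
    · simp [h1]
  · refine ⟨v 0 / u 0, ?_⟩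
    ext i; fin_cases i
    · simp [h0]
    · simp; field_simp; linarith

lemma exists_smul_quarterTurn_of_inner_eq_zero {u v : Plane} (hu : u ≠ 0)
    (h : inner ℝ u v = 0) : ∃ k : ℝ, v = k • quarterTurn u := by
  refine exists_smul_eq_of_inner_quarterTurn_eq_zero (by simpa using hu) ?_
  rw [quarterTurn_quarterTurn, inner_neg_left, h, neg_zero]

lemma volume_inner_eq_zero {u : Plane} (hu : u ≠ 0) :
    volume {v : Plane | inner ℝ u v = 0} = 0 := by
  have := Measure.addHaar_submodule (volume : Measure Plane) (LinearMap.ker (innerₗ Plane u)) (by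
    intro h
    have : u ∈ LinearMap.ker (innerₗ Plane u) := by rw [h]; trivial
    simp at this
    exact hu this)
  convert this using 2
  ext v
  simp

/-! ### Tangent cones, normal cones, and angles as areas -/

/-- The cone of directions pointing from `p` into `T`. -/
def tangentCone (T : Set Plane) (p : Plane) : Set Plane :=
  {v | ∃ t : ℝ, 0 < t ∧ p + t • v ∈ T}

/-- The cone of outer normals of `T` at `p`. -/
def normalCone (T : Set Plane) (p : Plane) : Set Plane :=
  {u | ∀ x ∈ T, inner ℝ u (x - p) ≤ 0}

/-- The angle of `T` at `p`, measured by the area of a sector of the unit disk. -/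
def innerAngle (T : Set Plane) (p : Plane) : ℝ :=
  volume.real (tangentCone T p ∩ ball 0 1)

/-- The exterior angle of `T` at `p`, measured by the area of a sector of the unit disk. -/
def outerAngle (T : Set Plane) (p : Plane) : ℝ :=
  volume.real (normalCone T p ∩ ball 0 1)

/-- The area of the unit disk. -/
def diskArea : ℝ := volume.real (ball (0 : Plane) 1)

lemma diskArea_pos : 0 < diskArea :=
  ENNReal.toReal_pos (measure_ball_pos volume _ one_pos).ne' measure_ball_lt_top.ne

lemma innerAngle_nonneg (T : Set Plane) (p : Plane) : 0 ≤ innerAngle T p := measureReal_nonneg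

lemma outerAngle_nonneg (T : Set Plane) (p : Plane) : 0 ≤ outerAngle T p := measureReal_nonneg

section Convex

variable {T : Set Plane} {p : Plane}

lemma add_smul_mem_of_le (hT : Convex ℝ T) (hp : p ∈ T) {v : Plane} {t s : ℝ}
    (h : p + t • v ∈ T) (hs : 0 ≤ s) (hst : s ≤ t) (ht : 0 < t) : p + s • v ∈ T := by
  have := hT.add_smul_sub_mem hp h (t := s / t) ⟨by positivity, div_le_one_of_le₀ hst ht.le⟩
  convert this using 2
  rw [add_sub_cancel_left, smul_smul, div_mul_cancel₀ _ ht.ne']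

lemma sub_mem_tangentCone {x : Plane} (hx : x ∈ T) : x - p ∈ tangentCone T p :=
  ⟨1, one_pos, by simpa using hx⟩

lemma smul_mem_tangentCone {v : Plane} (hv : v ∈ tangentCone T p) {k : ℝ} (hk : 0 < k) :
    k • v ∈ tangentCone T p := by
  obtain ⟨t, ht, h⟩ := hv
  refine ⟨t / k, by positivity, ?_⟩
  rwa [smul_smul, div_mul_cancel₀ _ hk.ne']

lemma mem_tangentCone_of_smul_mem {v : Plane} {k : ℝ} (hk : 0 < k)
    (hv : k • v ∈ tangentCone T p) : v ∈ tangentCone T p := by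
  simpa [smul_smul, hk.ne'] using smul_mem_tangentCone hv (inv_pos.2 hk)

lemma convex_tangentCone (hT : Convex ℝ T) (hp : p ∈ T) : Convex ℝ (tangentCone T p) := by
  rintro v ⟨t, ht, hv⟩ w ⟨s, hs, hw⟩ a b ha hb hab
  have hm : 0 < min t s := lt_min ht hs
  refine ⟨min t s, hm, ?_⟩
  have h1 := add_smul_mem_of_le hT hp hv hm.le (min_le_left _ _) ht
  have h2 := add_smul_mem_of_le hT hp hw hm.le (min_le_right _ _) hs
  have := hT h1 h2 ha hb hab
  convert this using 1
  obtain rfl : b = 1 - a := by linarith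
  module

lemma isClosed_normalCone : IsClosed (normalCone T p) := by
  simp only [normalCone, ofPred_forall]
  refine isClosed_iInter fun x => isClosed_iInter fun _ => ?_
  exact isClosed_le (by fun_prop) continuous_const

lemma mem_normalCone_iff {u : Plane} :
    u ∈ normalCone T p ↔ ∀ v ∈ tangentCone T p, inner ℝ u v ≤ 0 := by
  constructor
  · rintro h v ⟨t, ht, hv⟩
    have := h _ hv
    rw [add_sub_cancel_left, inner_smul_right] at this
    exact nonpos_of_mul_nonpos_right this ht
  · intro h x hx
    exact h _ (sub_mem_tangentCone hx)

/-- The supporting half-plane at a point that is not interior. -/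
lemma exists_supporting (hT : Convex ℝ T) (hi : (interior T).Nonempty) (hp : p ∉ interior T) :
    ∃ u : Plane, u ≠ 0 ∧ u ∈ normalCone T p ∧ ∀ x ∈ interior T, inner ℝ u (x - p) < 0 := by
  obtain ⟨f, hf⟩ := geometric_hahn_banach_open_point hT.interior isOpen_interior hp
  set u := (InnerProductSpace.toDual ℝ Plane).symm f
  have hu : ∀ x, f x = inner ℝ u x := fun x => by simp [u]
  have h1 : ∀ x ∈ interior T, inner ℝ u (x - p) < 0 := by
    intro x hx
    rw [inner_sub_right, ← hu, ← hu]
    linarith [hf x hx]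
  refine ⟨u, ?_, ?_, h1⟩
  · rintro h0
    obtain ⟨x, hx⟩ := hi
    have := h1 x hx
    rw [h0, inner_zero_left] at this
    exact lt_irrefl _ this
  · intro x hx
    have hx' : x ∈ closure (interior T) := by
      rw [hT.closure_interior_eq_closure_of_nonempty_interior hi]
      exact subset_closure hx
    exact closure_minimal (t := {y | inner ℝ u (y - p) ≤ 0}) (fun y hy => (h1 y hy).le)
      (isClosed_le (by fun_prop) continuous_const) hx'

/-- The map v ↦ -v exchanges the two open half-disks, and the diameter between them is null. -/
lemma volume_halfDisk {u : Plane} (hu : u ≠ 0) :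
    volume.real ({v : Plane | inner ℝ u v < 0} ∩ ball 0 1) = diskArea / 2 := by
  have hneg : volume.real ({v : Plane | 0 < inner ℝ u v} ∩ ball 0 1) =
      volume.real ({v : Plane | inner ℝ u v < 0} ∩ ball 0 1) := by
    have := (Measure.measurePreserving_neg (volume : Measure Plane)).measure_preimage
      (s := {v : Plane | inner ℝ u v < 0} ∩ ball 0 1)
      (((isOpen_lt (by fun_prop) continuous_const).inter isOpen_ball).nullMeasurableSet)
    rw [measureReal_def, measureReal_def, ← this]
    congr 2
    ext v; simp
  have hm : MeasurableSet ({v : Plane | 0 < inner ℝ u v} ∩ ball 0 1) :=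
    ((isOpen_lt continuous_const (by fun_prop)).inter isOpen_ball).measurableSet
  have hd : Disjoint ({v : Plane | inner ℝ u v < 0} ∩ ball 0 1)
      ({v : Plane | 0 < inner ℝ u v} ∩ ball 0 1) := by
    rw [Set.disjoint_left]
    rintro v ⟨h1, -⟩ ⟨h2, -⟩
    exact lt_asymm (mem_ofPred.1 h1) (mem_ofPred.1 h2)
  have hfin : ∀ s : Set Plane, volume (s ∩ ball 0 1) ≠ ⊤ := fun s =>
    measure_ne_top_of_subset inter_subset_right measure_ball_lt_top.ne
  have h := measureReal_union hd hm (hfin _) (hfin _)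
  have h0 : volume.real (({v : Plane | inner ℝ u v < 0} ∩ ball 0 1) ∪
      ({v : Plane | 0 < inner ℝ u v} ∩ ball 0 1)) = diskArea := by
    refine measureReal_congr ?_
    have : ∀ᵐ v : Plane, inner ℝ u v ≠ 0 := by
      rw [ae_iff]; simpa using volume_inner_eq_zero hu
    filter_upwards [this] with v hv
    apply propext
    constructor
    · rintro (h | h) <;> exact h.2
    · intro h
      rcases lt_or_gt_of_ne hv with h1 | h1
      · exact Or.inl ⟨h1, h⟩
      · exact Or.inr ⟨h1, h⟩
  rw [h0, hneg] at h
  linarith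

end Convex

/-! ### Interior and exterior angle at a boundary point -/

section Angle

variable {T : Set Plane} {p : Plane}

lemma quarterTurn_symm_apply (x : Plane) : quarterTurn.symm x = -quarterTurn x := by
  rw [LinearIsometryEquiv.symm_apply_eq, map_neg, quarterTurn_quarterTurn, neg_neg]

lemma inner_quarterTurn_self (x : Plane) : inner ℝ (quarterTurn x) x = 0 := by
  rw [inner_eq]; simp; ring

lemma volume_inter_ball_ne_top (s : Set Plane) : volume (s ∩ ball 0 1) ≠ ⊤ :=
  measure_ne_top_of_subset inter_subset_right measure_ball_lt_top.ne

/-- A small move from x in the direction w stays in `S` and increases the inner product, so equality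
is impossible at x. -/
lemma inner_neg_of_mem_interior {S : Set Plane} {w x : Plane} (hw : w ≠ 0)
    (h : ∀ y ∈ S, inner ℝ w (y - p) ≤ 0) (hx : x ∈ interior S) : inner ℝ w (x - p) < 0 := by
  have hc : Tendsto (fun t : ℝ => x + t • w) (𝓝[>] 0) (𝓝 x) := by
    have : Tendsto (fun t : ℝ => x + t • w) (𝓝 0) (𝓝 (x + (0 : ℝ) • w)) :=
      Continuous.tendsto (by fun_prop) 0
    rw [zero_smul, add_zero] at this
    exact this.mono_left nhdsWithin_le_nhds
  have h1 := hc.eventually (mem_interior_iff_mem_nhds.1 hx)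
  obtain ⟨t, ht, htpos⟩ := (h1.and self_mem_nhdsWithin).exists
  have h2 := h _ ht
  rw [add_sub_right_comm, inner_add_right, inner_smul_right, real_inner_self_eq_norm_sq] at h2
  have : 0 < t * ‖w‖ ^ 2 := mul_pos htpos (by positivity)
  linarith

/-- The vectors a and b lie on opposite sides of the line ℝv, so some convex combination of them
lies on that line. Its product with u is negative, as is that of v, so it is a positive multiple of
v. -/
lemma mem_tangentCone_of_crossing (hT : Convex ℝ T) (hp : p ∈ T) {u v a b : Plane}
    (huv : inner ℝ u v < 0) (ha : a ∈ tangentCone T p) (hb : b ∈ tangentCone T p)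
    (hva : 0 < inner ℝ (quarterTurn v) a) (hvb : inner ℝ (quarterTurn v) b < 0)
    (hua : inner ℝ u a ≤ 0) (hub : inner ℝ u b ≤ 0) (hab : inner ℝ u a + inner ℝ u b < 0) :
    v ∈ tangentCone T p := by
  have hv : v ≠ 0 := by rintro rfl; simp at huv
  set α := inner ℝ (quarterTurn v) a
  set β := inner ℝ (quarterTurn v) b
  have hs : 0 < α - β := by linarith
  have hw : (-β / (α - β)) • a + (α / (α - β)) • b ∈ tangentCone T p :=
    convex_tangentCone hT hp ha hb (div_nonneg (by linarith) hs.le) (by positivity)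
      (by field_simp; ring)
  obtain ⟨k, hk⟩ := exists_smul_eq_of_inner_quarterTurn_eq_zero hv
    (v := (-β / (α - β)) • a + (α / (α - β)) • b) (by
      rw [inner_add_right, inner_smul_right, inner_smul_right]
      change _ / _ * α + _ / _ * β = 0
      field_simp; ring)
  have hu : inner ℝ u ((-β / (α - β)) • a + (α / (α - β)) • b) < 0 := by
    rw [inner_add_right, inner_smul_right, inner_smul_right]
    have h1 : 0 < -β / (α - β) := div_pos (by linarith) hs
    have h2 : 0 < α / (α - β) := by positivity
    have h3 := mul_nonpos_of_nonneg_of_nonpos h1.le hua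
    have h4 := mul_nonpos_of_nonneg_of_nonpos h2.le hub
    rcases hua.lt_or_eq with h | h
    · linarith [mul_neg_of_pos_of_neg h1 h]
    · linarith [mul_neg_of_pos_of_neg h2 (show inner ℝ u b < 0 by linarith)]
  rw [hk] at hw hu
  rw [inner_smul_right] at hu
  exact mem_tangentCone_of_smul_mem (by nlinarith) hw

/-- This cuts the open half-plane below u into the tangent cone and two pieces that are quarter
turns of parts of the normal cone. If both turns of v fail to be normals, the cone has directions on
either side of ℝv; a direction to an interior point, strictly below u, is then paired with the one
opposite to it. -/
lemma mem_or_quarterTurn_mem_normalCone (hT : Convex ℝ T) (hi : (interior T).Nonempty)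
    (hp : p ∈ T) {u v : Plane} (hu : u ∈ normalCone T p)
    (hu' : ∀ x ∈ interior T, inner ℝ u (x - p) < 0) (huv : inner ℝ u v < 0) :
    v ∈ tangentCone T p ∨ quarterTurn v ∈ normalCone T p ∨ -quarterTurn v ∈ normalCone T p := by
  by_contra! h
  obtain ⟨h1, h2, h3⟩ := h
  have hv : v ≠ 0 := by rintro rfl; simp at huv
  rw [mem_normalCone_iff] at h2 h3 hu
  push Not at h2 h3
  obtain ⟨a, ha, hva⟩ := h2
  obtain ⟨b, hb, hvb⟩ := h3
  rw [inner_neg_left] at hvb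
  obtain ⟨x, hx⟩ := hi
  have hc := sub_mem_tangentCone (p := p) (interior_subset hx)
  have huc := hu' x hx
  rcases lt_trichotomy (inner ℝ (quarterTurn v) (x - p)) 0 with h | h | h
  · exact h1 (mem_tangentCone_of_crossing hT hp huv ha hc hva h (hu a ha) huc.le
      (by linarith [hu a ha]))
  · obtain ⟨k, hk⟩ := exists_smul_eq_of_inner_quarterTurn_eq_zero hv h
    rw [hk] at hc huc
    rw [inner_smul_right] at huc
    exact h1 (mem_tangentCone_of_smul_mem (by nlinarith) hc)
  · exact h1 (mem_tangentCone_of_crossing hT hp huv hc hb h (by linarith) huc.le (hu b hb)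
      (by linarith [hu b hb]))

/-- Interior and exterior angle at a boundary point add up to half a turn. -/
theorem innerAngle_add_outerAngle (hT : Convex ℝ T) (hi : (interior T).Nonempty)
    (hp : p ∈ T) (hp' : p ∉ interior T) : innerAngle T p + outerAngle T p = diskArea / 2 := by
  obtain ⟨u, hu0, hu, hu'⟩ := exists_supporting hT hi hp'
  set H : Set Plane := {v | inner ℝ u v < 0}
  have hH : MeasurableSet H := (isOpen_lt (by fun_prop) continuous_const).measurableSet
  have hN : MeasurableSet (normalCone T p) := isClosed_normalCone.measurableSet
  -- The line ℝu cuts the normal cone into `P` and `Q`. Turned by a quarter in opposite senses, they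
  -- become `Y` and `Z`, which fill the part of the half-disk left free by the tangent cone.
  set P : Set Plane := normalCone T p ∩ {w | 0 < inner ℝ u (quarterTurn w)} ∩ ball 0 1
  set Q : Set Plane := normalCone T p ∩ {w | inner ℝ u (quarterTurn w) < 0} ∩ ball 0 1
  have hP : MeasurableSet P := (hN.inter (isOpen_lt continuous_const (by
    have := quarterTurn.continuous; fun_prop)).measurableSet).inter measurableSet_ball
  have hQ : MeasurableSet Q := (hN.inter (isOpen_lt (by
    have := quarterTurn.continuous; fun_prop) continuous_const).measurableSet).inter
      measurableSet_ball
  set X : Set Plane := tangentCone T p ∩ H ∩ ball 0 1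
  set Y : Set Plane := quarterTurn ⁻¹' P
  set Z : Set Plane := quarterTurn.symm ⁻¹' Q
  have memY : ∀ v, v ∈ Y ↔ quarterTurn v ∈ normalCone T p ∧ inner ℝ u v < 0 ∧ ‖v‖ < 1 := by
    intro v
    simp [Y, P, quarterTurn_quarterTurn, and_assoc]
  have memZ : ∀ v, v ∈ Z ↔ -quarterTurn v ∈ normalCone T p ∧ inner ℝ u v < 0 ∧ ‖v‖ < 1 := by
    intro v
    simp [Z, Q, quarterTurn_symm_apply, quarterTurn_quarterTurn, and_assoc]
  have hYm : MeasurableSet Y := quarterTurn.continuous.measurable hP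
  have hZm : MeasurableSet Z := quarterTurn.symm.continuous.measurable hQ
  have hYv : volume.real Y = volume.real P := by
    rw [measureReal_def, measureReal_def,
      quarterTurn.measurePreserving.measure_preimage hP.nullMeasurableSet]
  have hZv : volume.real Z = volume.real Q := by
    rw [measureReal_def, measureReal_def,
      quarterTurn.symm.measurePreserving.measure_preimage hQ.nullMeasurableSet]
  have hPfin : volume P ≠ ⊤ := volume_inter_ball_ne_top _
  have hQfin : volume Q ≠ ⊤ := volume_inter_ball_ne_top _
  have hXfin : volume X ≠ ⊤ := volume_inter_ball_ne_top _
  have hYfin : volume Y ≠ ⊤ := by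
    rwa [quarterTurn.measurePreserving.measure_preimage hP.nullMeasurableSet]
  have hZfin : volume Z ≠ ⊤ := by
    rwa [quarterTurn.symm.measurePreserving.measure_preimage hQ.nullMeasurableSet]
  have houter : outerAngle T p = volume.real P + volume.real Q := by
    have hd : Disjoint P Q := by
      rw [Set.disjoint_left]
      rintro v ⟨⟨-, h1⟩, -⟩ ⟨⟨-, h2⟩, -⟩
      exact lt_asymm (mem_ofPred.1 h1) (mem_ofPred.1 h2)
    rw [← measureReal_union hd hQ hPfin hQfin]
    refine measureReal_congr ?_
    have : ∀ᵐ v : Plane, inner ℝ (quarterTurn u) v ≠ 0 := by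
      rw [ae_iff]; simpa using volume_inner_eq_zero (u := quarterTurn u) (by simpa using hu0)
    filter_upwards [this] with v hv
    have hv' : inner ℝ u (quarterTurn v) ≠ 0 := by
      contrapose! hv
      rw [inner_eq] at hv ⊢
      simp only [quarterTurn_zero, quarterTurn_one] at hv ⊢
      linarith
    apply propext
    constructor
    · rintro ⟨h1, h2⟩
      rcases lt_or_gt_of_ne hv' with h | h
      · exact Or.inr ⟨⟨h1, h⟩, h2⟩
      · exact Or.inl ⟨⟨h1, h⟩, h2⟩
    · rintro (h | h) <;> exact ⟨h.1.1, h.2⟩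
  have hinner : innerAngle T p = volume.real X := by
    refine measureReal_congr ?_
    have : ∀ᵐ v : Plane, inner ℝ u v ≠ 0 := by
      rw [ae_iff]; simpa using volume_inner_eq_zero hu0
    filter_upwards [this] with v hv
    apply propext
    constructor
    · rintro ⟨h1, h2⟩
      exact ⟨⟨h1, lt_of_le_of_ne (mem_normalCone_iff.1 hu v h1) hv⟩, h2⟩
    · rintro ⟨⟨h1, -⟩, h2⟩
      exact ⟨h1, h2⟩
  have hunion : H ∩ ball 0 1 = X ∪ Y ∪ Z := by
    ext v
    simp only [mem_union, memY, memZ]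
    constructor
    · rintro ⟨h1, h2⟩
      rcases mem_or_quarterTurn_mem_normalCone hT hi hp hu hu' h1 with h | h | h
      · exact Or.inl (Or.inl ⟨⟨h, h1⟩, h2⟩)
      · exact Or.inl (Or.inr ⟨h, h1, by simpa using h2⟩)
      · exact Or.inr ⟨h, h1, by simpa using h2⟩
    · rintro ((h | h) | h)
      · exact ⟨h.1.2, h.2⟩
      · exact ⟨h.2.1, by simpa using h.2.2⟩
      · exact ⟨h.2.1, by simpa using h.2.2⟩
  have hfr : ∀ v w : Plane, v ∈ tangentCone T p → w ∈ normalCone T p → inner ℝ w v = 0 →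
      w ≠ 0 → v ∈ frontier (tangentCone T p) := by
    intro v w hv hw hwv hw0
    refine ⟨subset_closure hv, fun hvi => ?_⟩
    have := inner_neg_of_mem_interior (p := 0) hw0
      (fun y hy => by simpa using mem_normalCone_iff.1 hw y hy) hvi
    rw [sub_zero, hwv] at this
    exact lt_irrefl _ this
  -- Overlaps of `X` with `Y` or `Z` lie on the frontier of a convex cone, hence are null. A vector
  -- in both `Y` and `Z` would force `T` into a line.
  have hv0 : ∀ {v}, inner ℝ u v < 0 → quarterTurn v ≠ 0 := by
    rintro v hv h
    rw [(map_eq_zero_iff quarterTurn quarterTurn.injective).1 h] at hv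
    simp at hv
  have hnull := (convex_tangentCone hT hp).addHaar_frontier volume
  have hXY : AEDisjoint volume X Y := by
    refine measure_mono_null ?_ hnull
    rintro v ⟨h1, h2⟩
    rw [memY] at h2
    exact hfr v _ h1.1.1 h2.1 (inner_quarterTurn_self v) (hv0 h2.2.1)
  have hXZ : AEDisjoint volume X Z := by
    refine measure_mono_null ?_ hnull
    rintro v ⟨h1, h2⟩
    rw [memZ] at h2
    exact hfr v _ h1.1.1 h2.1 (by rw [inner_neg_left, inner_quarterTurn_self, neg_zero])
      (neg_ne_zero.2 (hv0 h2.2.1))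
  have hYZ : AEDisjoint volume Y Z := by
    apply Disjoint.aedisjoint
    rw [Set.disjoint_left]
    intro v h1 h2
    rw [memY] at h1
    rw [memZ] at h2
    obtain ⟨x, hx⟩ := hi
    have h3 := inner_neg_of_mem_interior (hv0 h1.2.1) h1.1 hx
    have h4 := h2.1 x (interior_subset hx)
    rw [inner_neg_left] at h4
    linarith
  rw [hinner, houter, ← volume_halfDisk hu0, hunion,
    measureReal_union₀ hZm.nullMeasurableSet (hXZ.union_left hYZ)
      (measure_union_ne_top hXfin hYfin) hZfin,
    measureReal_union₀ hYm.nullMeasurableSet hXY hXfin hYfin, hYv, hZv, add_assoc]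

/-- A normal at a point strictly between a and b must be orthogonal to b - a, and such vectors form
a null line. -/
lemma outerAngle_eq_zero_of_mem_openSegment {a b : Plane} (ha : a ∈ T) (hb : b ∈ T)
    (hab : a ≠ b) (hp : p ∈ openSegment ℝ a b) : outerAngle T p = 0 := by
  obtain ⟨s, t, hs, ht, hst, rfl⟩ := hp
  have : normalCone T (s • a + t • b) ∩ ball 0 1 ⊆ {u | inner ℝ (b - a) u = 0} := by
    rintro u ⟨hu, -⟩
    have h1 := hu a ha
    have h2 := hu b hb
    obtain rfl : s = 1 - t := by linarith
    rw [show a - ((1 - t) • a + t • b) = (-t) • (b - a) by module, inner_smul_right] at h1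
    rw [show b - ((1 - t) • a + t • b) = (1 - t) • (b - a) by module, inner_smul_right] at h2
    rw [mem_ofPred, real_inner_comm]
    nlinarith
  rw [outerAngle, measureReal_def, measure_mono_null this (volume_inner_eq_zero
    (sub_ne_zero.2 hab.symm)), ENNReal.toReal_zero]

end Angle

/-! ### Exterior angles of a convex polygon -/

/-- A convex polygon with nonempty interior, described without naming its corners. -/
structure IsSolidPolygon (T : Set Plane) : Prop where
  convex : Convex ℝ T
  isCompact : IsCompact T
  interior_nonempty : (interior T).Nonempty
  finite_corners : (Set.extremePoints ℝ T).Finite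

lemma notMem_interior_of_mem_extremePoints {T : Set Plane} {p : Plane}
    (hp : p ∈ Set.extremePoints ℝ T) : p ∉ interior T := by
  intro hi
  obtain ⟨e, he, hb⟩ := Metric.mem_nhds_iff.1 (mem_interior_iff_mem_nhds.1 hi)
  obtain ⟨w, hw⟩ := exists_norm_eq (E := Plane) (c := e / 2) (by positivity)
  have h1 : p + w ∈ T := hb (by simp [hw]; linarith)
  have h2 : p - w ∈ T := hb (by simp [hw]; linarith)
  have := (mem_extremePoints.1 hp).2 _ h1 _ h2
    ⟨1 / 2, 1 / 2, by norm_num, by norm_num, by norm_num, by module⟩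
  have h3 : w = 0 := by simpa using this.1
  rw [h3, norm_zero] at hw
  linarith

namespace IsSolidPolygon

variable {T : Set Plane} {p : Plane}

lemma convexHull_extremePoints (hT : IsSolidPolygon T) :
    convexHull ℝ (Set.extremePoints ℝ T) = T := by
  have := closure_convexHull_extremePoints hT.isCompact hT.convex
  rwa [(hT.finite_corners.isClosed_convexHull ℝ).closure_eq] at this

lemma mem_normalCone_of_extremePoints (hT : IsSolidPolygon T) {u : Plane}
    (h : ∀ c ∈ Set.extremePoints ℝ T, inner ℝ u (c - p) ≤ 0) : u ∈ normalCone T p := by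
  intro x hx
  rw [← hT.convexHull_extremePoints] at hx
  refine convexHull_min (t := {y | inner ℝ u (y - p) ≤ 0}) h ?_ hx
  have : {y | inner ℝ u (y - p) ≤ 0} = {y | inner ℝ u y ≤ inner ℝ u p} := by
    ext y; simp [inner_sub_right]
  rw [this]
  exact convex_halfSpace_le (innerₗ Plane u).isLinear _

lemma exists_openSegment (hp : p ∈ T) (hp' : p ∉ Set.extremePoints ℝ T) :
    ∃ a ∈ T, ∃ b ∈ T, a ≠ b ∧ p ∈ openSegment ℝ a b := by
  rw [mem_extremePoints] at hp'
  push Not at hp'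
  obtain ⟨a, ha, b, hb, h, h'⟩ := hp' hp
  refine ⟨a, ha, b, hb, ?_, h⟩
  rintro rfl
  rw [openSegment_same, mem_singleton_iff] at h
  exact h' h.symm h.symm

lemma outerAngle_eq_zero (hp : p ∈ T) (hp' : p ∉ Set.extremePoints ℝ T) : outerAngle T p = 0 := by
  obtain ⟨a, ha, b, hb, h, h'⟩ := exists_openSegment hp hp'
  exact outerAngle_eq_zero_of_mem_openSegment ha hb h h'

/-- A corner is strictly separated from the hull of the finitely many other corners. The separating
normals form an open set, and it is contained in the normal cone. -/
lemma outerAngle_pos (hT : IsSolidPolygon T) (hp : p ∈ Set.extremePoints ℝ T) :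
    0 < outerAngle T p := by
  set E := Set.extremePoints ℝ T
  have hnot : p ∉ convexHull ℝ (E \ {p}) :=
    convexIndependent_set_iff_notMem_convexHull_sdiff.1 hT.convex.convexIndependent_extremePoints
      p hp
  have hfin : (E \ {p}).Finite := hT.finite_corners.sdiff
  obtain ⟨f, s, hf, hs⟩ := geometric_hahn_banach_closed_point (convex_convexHull ℝ (E \ {p}))
    (hfin.isClosed_convexHull ℝ) hnot
  set u := (InnerProductSpace.toDual ℝ Plane).symm f
  have hu : ∀ x, f x = inner ℝ u x := fun x => by simp [u]
  set W : Set Plane := {w | ∀ c ∈ E \ {p}, inner ℝ w (c - p) < 0}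
  have hW : IsOpen W := by
    have : W = ⋂ c ∈ E \ {p}, {w | inner ℝ w (c - p) < 0} := by
      ext w; simp [W]
    rw [this]
    exact hfin.isOpen_biInter fun c _ => isOpen_lt (by fun_prop) continuous_const
  have huW : u ∈ W := by
    intro c hc
    rw [inner_sub_right, ← hu, ← hu]
    linarith [hf c (subset_convexHull ℝ _ hc)]
  have hk : 0 < (‖u‖ + 1)⁻¹ := by positivity
  have hkW : (‖u‖ + 1)⁻¹ • u ∈ W ∩ ball 0 1 := by
    refine ⟨fun c hc => ?_, ?_⟩
    · rw [inner_smul_left]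
      exact mul_neg_of_pos_of_neg hk (huW c hc)
    · rw [mem_ball_zero_iff, norm_smul, Real.norm_of_nonneg hk.le, inv_mul_lt_one₀ (by positivity)]
      linarith
  have hpos := (hW.inter isOpen_ball).measure_pos volume ⟨_, hkW⟩
  have hsub : W ∩ ball 0 1 ⊆ normalCone T p ∩ ball 0 1 := by
    refine inter_subset_inter_left _ fun w hw => hT.mem_normalCone_of_extremePoints fun c hc => ?_
    by_cases hcp : c = p
    · simp [hcp]
    · exact (hw c ⟨hc, hcp⟩).le
  exact ENNReal.toReal_pos (hpos.trans_le (measure_mono hsub)).ne' (volume_inter_ball_ne_top _)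

/-- The exterior angles of a convex polygon add up to a full turn. -/
lemma sum_outerAngle (hT : IsSolidPolygon T) :
    ∑ c ∈ hT.finite_corners.toFinset, outerAngle T c = diskArea := by
  set E := hT.finite_corners.toFinset
  have hd : ∀ c ∈ E, ∀ d ∈ E, c ≠ d →
      AEDisjoint volume (normalCone T c ∩ ball 0 1) (normalCone T d ∩ ball 0 1) := by
    intro c hc d hd hcd
    have hc' := extremePoints_subset ((Set.Finite.mem_toFinset _).1 hc)
    have hd' := extremePoints_subset ((Set.Finite.mem_toFinset _).1 hd)
    refine measure_mono_null ?_ (volume_inner_eq_zero (sub_ne_zero.2 hcd))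
    rintro u ⟨⟨h1, -⟩, ⟨h2, -⟩⟩
    have h3 := h1 d hd'
    have h4 := h2 c hc'
    rw [← neg_sub, inner_neg_right] at h3
    rw [mem_ofPred, real_inner_comm]
    linarith
  have hne : E.Nonempty := by
    rw [Set.Finite.toFinset_nonempty]
    exact hT.isCompact.extremePoints_nonempty (hT.interior_nonempty.mono interior_subset)
  -- Every vector u is a normal at a corner where the inner product with u is largest.
  have hU : ⋃ c ∈ E, (normalCone T c ∩ ball 0 1) = ball (0 : Plane) 1 := by
    ext u
    simp only [mem_iUnion, exists_prop]
    constructor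
    · rintro ⟨c, -, -, h⟩
      exact h
    · intro h
      obtain ⟨c, hc, hmax⟩ := E.exists_max_image (fun c => inner ℝ u c) hne
      refine ⟨c, hc, hT.mem_normalCone_of_extremePoints fun d hd => ?_, h⟩
      rw [inner_sub_right]
      linarith [hmax d ((Set.Finite.mem_toFinset _).2 hd)]
  have hm : ∀ c ∈ E, NullMeasurableSet (normalCone T c ∩ ball 0 1) volume := fun c _ =>
    (isClosed_normalCone.measurableSet.inter measurableSet_ball).nullMeasurableSet
  have := measure_biUnion_finset₀ (μ := volume) (s := E)
    (f := fun c => normalCone T c ∩ ball 0 1) hd hm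
  rw [hU] at this
  rw [diskArea, measureReal_def, this, ENNReal.toReal_sum fun c _ => volume_inter_ball_ne_top _]
  rfl

end IsSolidPolygon

/-! ### Local finiteness and the angles around a point -/

/-- A tiling by convex polygons that contain a disk of radius `u` and are contained in a disk of
radius `U`. -/
structure IsPolygonTiling (𝒯 : Set (Set Plane)) (u U : ℝ) : Prop where
  isTiling : IsTiling 𝒯
  solid : ∀ T ∈ 𝒯, IsSolidPolygon T
  u_pos : 0 < u
  U_pos : 0 < U
  exists_closedBall_subset : ∀ T ∈ 𝒯, ∃ x, closedBall x u ⊆ T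
  exists_subset_closedBall : ∀ T ∈ 𝒯, ∃ y, T ⊆ closedBall y U

/-- The tiles containing the point `p`. -/
def tilesAt (𝒯 : Set (Set Plane)) (p : Plane) : Set (Set Plane) := {T | T ∈ 𝒯 ∧ p ∈ T}

lemma volume_real_closedBall (x : Plane) {r : ℝ} (hr : 0 ≤ r) :
    volume.real (closedBall x r) = r ^ 2 * diskArea := by
  rw [Measure.addHaar_real_closedBall volume x hr, finrank_euclideanSpace_fin, diskArea]

namespace IsPolygonTiling

variable {𝒯 : Set (Set Plane)} {u U : ℝ} {S T : Set Plane} {p : Plane}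

lemma disjoint_interior (h : IsPolygonTiling 𝒯 u U) (hS : S ∈ 𝒯) (hT : T ∈ 𝒯) (hST : S ≠ T) :
    Disjoint (interior S) (interior T) := h.isTiling.2 S hS T hT hST

lemma subset_closure_interior (h : IsPolygonTiling 𝒯 u U) (hS : S ∈ 𝒯) :
    S ⊆ closure (interior S) := by
  rw [(h.solid S hS).convex.closure_interior_eq_closure_of_nonempty_interior
    (h.solid S hS).interior_nonempty]
  exact subset_closure

lemma volume_inter (h : IsPolygonTiling 𝒯 u U) (hS : S ∈ 𝒯) (hT : T ∈ 𝒯) (hST : S ≠ T) :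
    volume (S ∩ T) = 0 := by
  refine measure_mono_null ?_
    (((h.solid S hS).convex.inter (h.solid T hT).convex).addHaar_frontier volume)
  intro x hx
  refine ⟨subset_closure hx, ?_⟩
  rw [interior_inter, (h.disjoint_interior hS hT hST).inter_eq]
  exact notMem_empty x

lemma notMem_interior (h : IsPolygonTiling 𝒯 u U) (hS : S ∈ 𝒯) (hT : T ∈ 𝒯) (hST : S ≠ T)
    (hpS : p ∈ S) : p ∉ interior T := by
  intro hp
  obtain ⟨x, hx1, hx2⟩ := mem_closure_iff.1 (h.subset_closure_interior hS hpS) _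
    isOpen_interior hp
  exact Set.disjoint_left.1 (h.disjoint_interior hS hT hST) hx2 hx1

/-- A line separating two tiles with a common point. -/
lemma exists_separating (h : IsPolygonTiling 𝒯 u U) (hS : S ∈ 𝒯) (hT : T ∈ 𝒯) (hST : S ≠ T)
    (hpS : p ∈ S) (hpT : p ∈ T) :
    ∃ w : Plane, w ≠ 0 ∧ w ∈ normalCone S p ∧ -w ∈ normalCone T p := by
  obtain ⟨f, s, hf1, hf2⟩ := geometric_hahn_banach_open (h.solid S hS).convex.interior
    isOpen_interior (h.solid T hT).convex.interior (h.disjoint_interior hS hT hST)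
  set w := (InnerProductSpace.toDual ℝ Plane).symm f
  have hw : ∀ x, f x = inner ℝ w x := fun x => by simp [w]
  have h1 : ∀ x ∈ S, f x ≤ s := fun x hx =>
    closure_minimal (t := {x | f x ≤ s}) (fun y hy => (hf1 y hy).le)
      (isClosed_le f.continuous continuous_const) (h.subset_closure_interior hS hx)
  have h2 : ∀ x ∈ T, s ≤ f x := fun x hx =>
    closure_minimal (t := {x | s ≤ f x}) (fun y hy => hf2 y hy)
      (isClosed_le continuous_const f.continuous) (h.subset_closure_interior hT hx)
  have hp : f p = s := le_antisymm (h1 p hpS) (h2 p hpT)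
  refine ⟨w, ?_, fun x hx => ?_, fun x hx => ?_⟩
  · intro h0
    obtain ⟨x, hx⟩ := (h.solid S hS).interior_nonempty
    have h3 := hf1 x hx
    rw [← hp, hw, hw, h0, inner_zero_left, inner_zero_left] at h3
    exact lt_irrefl _ h3
  · rw [inner_sub_right, ← hw, ← hw]
    linarith [h1 x hx]
  · rw [inner_neg_left, inner_sub_right, ← hw, ← hw]
    linarith [h2 x hx]

lemma subset_closedBall (h : IsPolygonTiling 𝒯 u U) (hT : T ∈ 𝒯) (hp : p ∈ T) :
    T ⊆ closedBall p (2 * U) := by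
  obtain ⟨y, hy⟩ := h.exists_subset_closedBall T hT
  intro x hx
  have h1 := mem_closedBall.1 (hy hx)
  have h2 := mem_closedBall'.1 (hy hp)
  rw [mem_closedBall]
  linarith [dist_triangle x y p]

lemma volume_ne_top (h : IsPolygonTiling 𝒯 u U) (hT : T ∈ 𝒯) : volume T ≠ ⊤ :=
  (h.solid T hT).isCompact.measure_lt_top.ne

/-- Area bound for the number of tiles in a region. -/
lemma card_mul_le (h : IsPolygonTiling 𝒯 u U) {R : Set Plane} (hR : volume R ≠ ⊤)
    (F : Finset (Set Plane)) (hF : ∀ T ∈ F, T ∈ 𝒯 ∧ T ⊆ R) :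
    (F.card : ℝ) * (u ^ 2 * diskArea) ≤ volume.real R := by
  have h1 : volume (⋃ T ∈ F, T) = ∑ T ∈ F, volume T :=
    measure_biUnion_finset₀ (fun S hS T hT hST => h.volume_inter (hF S hS).1 (hF T hT).1 hST)
      fun T hT => (h.solid T (hF T hT).1).convex.nullMeasurableSet volume
  have h2 : ∑ T ∈ F, volume.real T ≤ volume.real R := by
    simp only [measureReal_def]
    rw [← ENNReal.toReal_sum fun T hT => h.volume_ne_top (hF T hT).1, ← h1]
    exact ENNReal.toReal_mono hR (measure_mono (iUnion₂_subset fun T hT => (hF T hT).2))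
  refine le_trans ?_ h2
  rw [← nsmul_eq_mul]
  refine Finset.card_nsmul_le_sum _ _ _ fun T hT => ?_
  obtain ⟨x, hx⟩ := h.exists_closedBall_subset T (hF T hT).1
  rw [← volume_real_closedBall x h.u_pos.le]
  exact measureReal_mono hx (h.volume_ne_top (hF T hT).1)

lemma finite_subset (h : IsPolygonTiling 𝒯 u U) {R : Set Plane} (hR : volume R ≠ ⊤) :
    {T | T ∈ 𝒯 ∧ T ⊆ R}.Finite := by
  by_contra hinf
  have hpos : 0 < u ^ 2 * diskArea := mul_pos (pow_pos h.u_pos 2) diskArea_pos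
  obtain ⟨n, hn⟩ := exists_nat_gt (volume.real R / (u ^ 2 * diskArea))
  obtain ⟨F, hF, hcard⟩ := Set.Infinite.exists_subset_card_eq hinf n
  have := h.card_mul_le hR F fun T hT => hF hT
  rw [hcard] at this
  rw [div_lt_iff₀ hpos] at hn
  linarith

lemma finite_meeting (h : IsPolygonTiling 𝒯 u U) (M : Plane) (r : ℝ) :
    {T | T ∈ 𝒯 ∧ (T ∩ closedBall M r).Nonempty}.Finite := by
  refine (h.finite_subset (R := closedBall M (r + 2 * U)) measure_closedBall_lt_top.ne).subset ?_
  rintro T ⟨hT, x, hx, hxM⟩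
  refine ⟨hT, (h.subset_closedBall hT hx).trans (closedBall_subset_closedBall' ?_)⟩
  rw [mem_closedBall] at hxM
  linarith

lemma finite_tilesAt (h : IsPolygonTiling 𝒯 u U) (p : Plane) : (tilesAt 𝒯 p).Finite :=
  (h.finite_meeting p 0).subset fun _ hT => ⟨hT.1, p, hT.2, by simp⟩

lemma exists_mem (h : IsPolygonTiling 𝒯 u U) (x : Plane) : ∃ T ∈ 𝒯, x ∈ T := by
  have : x ∈ ⋃₀ 𝒯 := by rw [h.isTiling.1]; trivial
  exact this

/-- Only finitely many tiles come within distance 1 of p, so those that miss p have a closed union,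
which stays away from p. -/
lemma exists_ball_subset (h : IsPolygonTiling 𝒯 u U) (p : Plane) :
    ∃ e > 0, ∀ x ∈ ball p e, ∃ T ∈ tilesAt 𝒯 p, x ∈ T := by
  have hfin : {T | (T ∈ 𝒯 ∧ (T ∩ closedBall p 1).Nonempty) ∧ p ∉ T}.Finite :=
    (h.finite_meeting p 1).subset fun _ hT => hT.1
  have hclosed : IsClosed (⋃₀ {T | (T ∈ 𝒯 ∧ (T ∩ closedBall p 1).Nonempty) ∧ p ∉ T}) := by
    rw [sUnion_eq_biUnion]
    exact hfin.isClosed_biUnion fun T hT => (h.solid T hT.1.1).isCompact.isClosed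
  have hp : p ∈ (⋃₀ {T | (T ∈ 𝒯 ∧ (T ∩ closedBall p 1).Nonempty) ∧ p ∉ T})ᶜ := by
    rintro ⟨T, hT, hpT⟩
    exact hT.2 hpT
  obtain ⟨e, he, hb⟩ := Metric.isOpen_iff.1 hclosed.isOpen_compl p hp
  refine ⟨min e 1, lt_min he one_pos, fun x hx => ?_⟩
  obtain ⟨T, hT, hxT⟩ := h.exists_mem x
  refine ⟨T, ⟨hT, ?_⟩, hxT⟩
  by_contra hpT
  refine hb (ball_subset_ball (min_le_left _ _) hx) ⟨T, ⟨⟨hT, x, hxT, ?_⟩, hpT⟩, hxT⟩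
  exact ball_subset_closedBall (ball_subset_ball (min_le_right _ _) hx)

lemma exists_mem_tangentCone (h : IsPolygonTiling 𝒯 u U) (p v : Plane) :
    ∃ T ∈ tilesAt 𝒯 p, v ∈ tangentCone T p := by
  obtain ⟨e, he, hb⟩ := h.exists_ball_subset p
  have hv : 0 < ‖v‖ + 1 := by positivity
  have ht : 0 < e / (‖v‖ + 1) := by positivity
  obtain ⟨T, hT, hmem⟩ := hb (p + (e / (‖v‖ + 1)) • v) (by
    rw [mem_ball, dist_self_add_left, norm_smul, Real.norm_of_nonneg ht.le, div_mul_eq_mul_div,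
      div_lt_iff₀ hv]
    linarith)
  exact ⟨T, hT, _, ht, hmem⟩

/-- The angles around a point add up to a full turn. -/
theorem sum_innerAngle (h : IsPolygonTiling 𝒯 u U) (p : Plane) :
    ∑ T ∈ (h.finite_tilesAt p).toFinset, innerAngle T p = diskArea := by
  set E := (h.finite_tilesAt p).toFinset
  have hE : ∀ T, T ∈ E ↔ T ∈ 𝒯 ∧ p ∈ T := fun T => Set.Finite.mem_toFinset _
  -- A line separating the two tiles at p contains the overlap of their tangent cones.
  have hd : ∀ S ∈ E, ∀ T ∈ E, S ≠ T →
      AEDisjoint volume (tangentCone S p ∩ ball 0 1) (tangentCone T p ∩ ball 0 1) := by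
    intro S hS T hT hST
    rw [hE] at hS hT
    obtain ⟨w, hw, h1, h2⟩ := h.exists_separating hS.1 hT.1 hST hS.2 hT.2
    refine measure_mono_null ?_ (volume_inner_eq_zero hw)
    rintro v ⟨⟨hv1, -⟩, ⟨hv2, -⟩⟩
    have h3 := mem_normalCone_iff.1 h1 v hv1
    have h4 := mem_normalCone_iff.1 h2 v hv2
    rw [inner_neg_left] at h4
    rw [mem_ofPred]
    linarith
  have hU : ⋃ T ∈ E, (tangentCone T p ∩ ball 0 1) = ball (0 : Plane) 1 := by
    ext v
    simp only [mem_iUnion, exists_prop]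
    constructor
    · rintro ⟨c, -, -, h⟩
      exact h
    · intro hv
      obtain ⟨T, hT, hvT⟩ := h.exists_mem_tangentCone p v
      exact ⟨T, (hE T).2 hT, hvT, hv⟩
  have hm : ∀ T ∈ E, NullMeasurableSet (tangentCone T p ∩ ball 0 1) volume := fun T hT =>
    ((convex_tangentCone (h.solid T ((hE T).1 hT).1).convex ((hE T).1 hT).2).nullMeasurableSet
      volume).inter measurableSet_ball.nullMeasurableSet
  have := measure_biUnion_finset₀ hd hm
  rw [hU] at this
  rw [diskArea, measureReal_def, this, ENNReal.toReal_sum fun c _ => volume_inter_ball_ne_top _]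
  rfl

end IsPolygonTiling

/-! ### Nodes of a tile and their relation to adjacents -/

/-- The points of the tile `T` at which at least three tiles meet. -/
def nodes (𝒯 : Set (Set Plane)) (T : Set Plane) : Set Plane :=
  {p | p ∈ T ∧ 3 ≤ (tilesAt 𝒯 p).ncard}

/-- Since p lies strictly between a and b, the segment must lie in the supporting line orthogonal to
w, so `S` extends from p in both directions of that line. -/
lemma mem_tangentCone_of_openSegment {S : Set Plane} {a b p v w : Plane} (ha : a ∈ S) (hb : b ∈ S)
    (hab : a ≠ b) (hp : p ∈ openSegment ℝ a b) (hpS : p ∈ S) (hw : w ≠ 0)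
    (hwN : w ∈ normalCone S p) (hv : inner ℝ w v = 0) : v ∈ tangentCone S p := by
  obtain ⟨s, t, hs, ht, hst, rfl⟩ := hp
  have h1 := hwN a ha
  have h2 := hwN b hb
  have ha' := sub_mem_tangentCone (p := s • a + t • b) ha
  have hb' := sub_mem_tangentCone (p := s • a + t • b) hb
  obtain rfl : s = 1 - t := by linarith
  rw [show a - ((1 - t) • a + t • b) = t • (a - b) by module] at h1 ha'
  rw [show b - ((1 - t) • a + t • b) = (1 - t) • (b - a) by module] at h2 hb'
  replace ha' := mem_tangentCone_of_smul_mem ht ha'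
  replace hb' := mem_tangentCone_of_smul_mem hs hb'
  rw [inner_smul_right] at h1 h2
  rw [← neg_sub a b, inner_neg_right] at h2
  have he : inner ℝ w (a - b) = 0 := by nlinarith
  obtain ⟨k, hk⟩ := exists_smul_quarterTurn_of_inner_eq_zero hw he
  obtain ⟨m, rfl⟩ := exists_smul_quarterTurn_of_inner_eq_zero hw hv
  have hk0 : k ≠ 0 := by
    rintro rfl
    rw [zero_smul, sub_eq_zero] at hk
    exact hab hk
  have hm : m • quarterTurn w = (m / k) • (a - b) := by
    rw [hk, smul_smul, div_mul_cancel₀ _ hk0]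
  rw [hm]
  rcases lt_trichotomy (m / k) 0 with h | h | h
  · rw [show (m / k) • (a - b) = (-(m / k)) • (b - a) by module]
    exact smul_mem_tangentCone hb' (by linarith)
  · rw [h, zero_smul]
    exact ⟨1, one_pos, by simpa using hpS⟩
  · exact smul_mem_tangentCone ha' h

namespace IsPolygonTiling

variable {𝒯 : Set (Set Plane)} {u U : ℝ} {S T : Set Plane} {p : Plane}

lemma innerAngle_add_outerAngle (h : IsPolygonTiling 𝒯 u U) (hT : T ∈ 𝒯) (hp : p ∈ T)
    (hi : p ∉ interior T) : innerAngle T p + outerAngle T p = diskArea / 2 :=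
  PlaneTiling.innerAngle_add_outerAngle (h.solid T hT).convex (h.solid T hT).interior_nonempty hp hi

lemma innerAngle_le (h : IsPolygonTiling 𝒯 u U) (hT : T ∈ 𝒯) (hp : p ∈ T)
    (hi : p ∉ interior T) : innerAngle T p ≤ diskArea / 2 := by
  linarith [h.innerAngle_add_outerAngle hT hp hi, outerAngle_nonneg T p]

/-- Corners of tiles are nodes. -/
lemma extremePoints_subset_nodes (h : IsPolygonTiling 𝒯 u U) (hT : T ∈ 𝒯) :
    Set.extremePoints ℝ T ⊆ nodes 𝒯 T := by
  intro p hp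
  have hpT := extremePoints_subset hp
  refine ⟨hpT, ?_⟩
  by_contra hlt
  rw [Set.ncard_eq_toFinset_card _ (h.finite_tilesAt p)] at hlt
  have hsum := h.sum_innerAngle p
  have hTE : T ∈ (h.finite_tilesAt p).toFinset := (Set.Finite.mem_toFinset _).2 ⟨hT, hpT⟩
  set E := (h.finite_tilesAt p).toFinset
  have hpi := notMem_interior_of_mem_extremePoints hp
  -- No tile has more than half a turn at p, and `T` has strictly less; two tiles cannot fill a full
  -- turn.
  have h1 : ∑ R ∈ E, innerAngle R p < ∑ R ∈ E, diskArea / 2 := by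
    refine Finset.sum_lt_sum (fun R hR => ?_) ⟨T, hTE, ?_⟩
    · have hR' := (Set.Finite.mem_toFinset (h.finite_tilesAt p)).1 hR
      by_cases hRT : R = T
      · rw [hRT]
        exact h.innerAngle_le hT hpT hpi
      · exact h.innerAngle_le hR'.1 hR'.2 (h.notMem_interior hT hR'.1 (Ne.symm hRT) hpT)
    · linarith [h.innerAngle_add_outerAngle hT hpT hpi, (h.solid T hT).outerAngle_pos hp]
  rw [hsum, Finset.sum_const, nsmul_eq_mul] at h1
  have h2 : (E.card : ℝ) ≤ 2 := by exact_mod_cast (by omega : E.card ≤ 2)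
  nlinarith [diskArea_pos]

/-- Three tiles have at most one point in common. -/
lemma eq_of_mem_three (h : IsPolygonTiling 𝒯 u U) {R : Set Plane} (hR : R ∈ 𝒯) (hS : S ∈ 𝒯)
    (hT : T ∈ 𝒯) (hRS : R ≠ S) (hRT : R ≠ T) (hST : S ≠ T) {a b : Plane}
    (ha : a ∈ R ∧ a ∈ S ∧ a ∈ T) (hb : b ∈ R ∧ b ∈ S ∧ b ∈ T) : a = b := by
  by_contra hab
  -- At the midpoint each of the three tiles would have a straight angle, one and a half turns in
  -- total.
  set m : Plane := midpoint ℝ a b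
  have hm : m ∈ openSegment ℝ a b :=
    ⟨1 / 2, 1 / 2, by norm_num, by norm_num, by norm_num, by
      simp only [m, midpoint_eq_smul_add, smul_add]; norm_num⟩
  have key : ∀ {X Y}, X ∈ 𝒯 → Y ∈ 𝒯 → X ≠ Y → a ∈ X → b ∈ X → a ∈ Y → b ∈ Y →
      m ∈ X ∧ innerAngle X m = diskArea / 2 := by
    intro X Y hX hY hXY haX hbX haY hbY
    have hmX : m ∈ X := (h.solid X hX).convex.openSegment_subset haX hbX hm
    have hmY : m ∈ Y := (h.solid Y hY).convex.openSegment_subset haY hbY hm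
    refine ⟨hmX, ?_⟩
    have := h.innerAngle_add_outerAngle hX hmX (h.notMem_interior hY hX hXY.symm hmY)
    rwa [outerAngle_eq_zero_of_mem_openSegment haX hbX hab hm, add_zero] at this
  obtain ⟨hmR, eR⟩ := key hR hS hRS ha.1 hb.1 ha.2.1 hb.2.1
  obtain ⟨hmS, eS⟩ := key hS hR hRS.symm ha.2.1 hb.2.1 ha.1 hb.1
  obtain ⟨hmT, eT⟩ := key hT hR hRT.symm ha.2.2 hb.2.2 ha.1 hb.1
  classical
  have hsub : ({R, S, T} : Finset (Set Plane)) ⊆ (h.finite_tilesAt m).toFinset := by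
    intro X hX
    simp only [Finset.mem_insert, Finset.mem_singleton] at hX
    rw [Set.Finite.mem_toFinset]
    rcases hX with rfl | rfl | rfl
    · exact ⟨hR, hmR⟩
    · exact ⟨hS, hmS⟩
    · exact ⟨hT, hmT⟩
  have h1 := Finset.sum_le_sum_of_subset_of_nonneg (f := fun X => innerAngle X m) hsub
    fun X _ _ => innerAngle_nonneg X m
  rw [h.sum_innerAngle m, Finset.sum_insert (by simp [hRS, hRT]), Finset.sum_pair hST,
    eR, eS, eT] at h1
  linarith [diskArea_pos]

lemma exists_two_others (h : IsPolygonTiling 𝒯 u U) (hT : T ∈ 𝒯) (hp : p ∈ nodes 𝒯 T) :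
    ∃ R S, R ∈ tilesAt 𝒯 p ∧ S ∈ tilesAt 𝒯 p ∧ R ≠ S ∧ R ≠ T ∧ S ≠ T := by
  have hmem : T ∈ tilesAt 𝒯 p := ⟨hT, hp.1⟩
  have h1 : 1 < (tilesAt 𝒯 p \ {T}).ncard := by
    rw [Set.ncard_sdiff_singleton_of_mem hmem]
    have := hp.2
    omega
  obtain ⟨R, S, hR, hS, hRS⟩ := (Set.one_lt_ncard_iff (h.finite_tilesAt p).sdiff).1 h1
  exact ⟨R, S, hR.1, hS.1, hRS, hR.2, hS.2⟩

lemma notMem_interior_of_mem_nodes (h : IsPolygonTiling 𝒯 u U) (hT : T ∈ 𝒯)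
    (hp : p ∈ nodes 𝒯 T) : p ∉ interior T := by
  obtain ⟨R, -, hR, -, -, hRT, -⟩ := h.exists_two_others hT hp
  exact h.notMem_interior hR.1 hT hRT hR.2

/-- Tiles touching `T` lie in a disk of radius 4U, and each covers at least the area of a disk of
radius u. -/
lemma finite_touching (h : IsPolygonTiling 𝒯 u U) (hT : T ∈ 𝒯) :
    {S | S ∈ 𝒯 ∧ (S ∩ T).Nonempty}.Finite ∧
      ({S | S ∈ 𝒯 ∧ (S ∩ T).Nonempty}.ncard : ℝ) ≤ 16 * U ^ 2 / u ^ 2 := by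
  obtain ⟨x, hx⟩ := (h.solid T hT).interior_nonempty.mono interior_subset
  have hsub : ∀ S, S ∈ 𝒯 ∧ (S ∩ T).Nonempty → S ∈ 𝒯 ∧ S ⊆ closedBall x (4 * U) := by
    rintro S ⟨hS, y, hyS, hyT⟩
    refine ⟨hS, (h.subset_closedBall hS hyS).trans (closedBall_subset_closedBall' ?_)⟩
    have := mem_closedBall.1 (h.subset_closedBall hT hx hyT)
    linarith
  have hfin : {S | S ∈ 𝒯 ∧ (S ∩ T).Nonempty}.Finite :=
    (h.finite_subset (R := closedBall x (4 * U)) measure_closedBall_lt_top.ne).subset hsub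
  refine ⟨hfin, ?_⟩
  rw [Set.ncard_eq_toFinset_card _ hfin]
  have := h.card_mul_le (R := closedBall x (4 * U)) measure_closedBall_lt_top.ne hfin.toFinset
    fun S hS => hsub S (mem_ofPred.1 (hfin.mem_toFinset.1 hS))
  rw [volume_real_closedBall x (by linarith [h.U_pos]), ← mul_assoc] at this
  rw [le_div_iff₀ (pow_pos h.u_pos 2)]
  nlinarith [le_of_mul_le_mul_right this diskArea_pos]

/-- A node is determined by two further tiles containing it, by `eq_of_mem_three`, so nodes inject
into pairs of touching tiles. -/
lemma finite_nodes (h : IsPolygonTiling 𝒯 u U) (hT : T ∈ 𝒯) :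
    (nodes 𝒯 T).Finite ∧ ((nodes 𝒯 T).ncard : ℝ) ≤ (16 * U ^ 2 / u ^ 2) ^ 2 := by
  obtain ⟨hfin, hcard⟩ := h.finite_touching hT
  set N := {S | S ∈ 𝒯 ∧ (S ∩ T).Nonempty}
  choose! f g hf hg hfg hfT hgT using fun p (hp : p ∈ nodes 𝒯 T) => h.exists_two_others hT hp
  have hmaps : ∀ p ∈ nodes 𝒯 T, (f p, g p) ∈ N ×ˢ N := fun p hp =>
    ⟨⟨(hf p hp).1, p, (hf p hp).2, hp.1⟩, ⟨(hg p hp).1, p, (hg p hp).2, hp.1⟩⟩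
  have hinj : InjOn (fun p => (f p, g p)) (nodes 𝒯 T) := by
    intro p hp q hq hpq
    obtain ⟨h1, h2⟩ := Prod.mk.inj hpq
    refine h.eq_of_mem_three (hf p hp).1 (hg p hp).1 hT (hfg p hp) (hfT p hp) (hgT p hp)
      ⟨(hf p hp).2, (hg p hp).2, hp.1⟩ ⟨?_, ?_, hq.1⟩
    · rw [h1]; exact (hf q hq).2
    · rw [h2]; exact (hg q hq).2
  have hNN : (N ×ˢ N).Finite := hfin.prod hfin
  refine ⟨Set.Finite.of_injOn hmaps hinj hNN, ?_⟩
  have h1 := Set.ncard_le_ncard_of_injOn _ hmaps hinj hNN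
  rw [Set.ncard_prod] at h1
  calc ((nodes 𝒯 T).ncard : ℝ) ≤ N.ncard * N.ncard := by exact_mod_cast h1
    _ ≤ _ := by rw [sq]; gcongr

lemma sum_nodes (h : IsPolygonTiling 𝒯 u U) (hT : T ∈ 𝒯) :
    ∑ p ∈ (h.finite_nodes hT).1.toFinset, (diskArea / 2 - innerAngle T p) = diskArea := by
  refine Eq.trans ?_ (h.solid T hT).sum_outerAngle
  have hsub : (h.solid T hT).finite_corners.toFinset ⊆ (h.finite_nodes hT).1.toFinset := by
    rw [Set.Finite.toFinset_subset_toFinset]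
    exact h.extremePoints_subset_nodes hT
  rw [Finset.sum_subset hsub]
  · refine Finset.sum_congr rfl fun p hp => ?_
    rw [Set.Finite.mem_toFinset] at hp
    linarith [h.innerAngle_add_outerAngle hT hp.1 (h.notMem_interior_of_mem_nodes hT hp)]
  · intro p hp hp'
    rw [Set.Finite.mem_toFinset] at hp hp'
    exact IsSolidPolygon.outerAngle_eq_zero hp.1 hp'

/-- The endpoints of an edge are nodes. -/
lemma mem_nodes_of_endpoint (h : IsPolygonTiling 𝒯 u U) (hS : S ∈ 𝒯) (hT : T ∈ 𝒯) (hST : S ≠ T)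
    {q : Plane} (hpS : p ∈ S) (hpT : p ∈ T) (hqS : q ∈ S) (hqT : q ∈ T) (hpq : q ≠ p)
    (hmin : ∀ x ∈ S, x ∈ T → 0 ≤ inner ℝ (q - p) (x - p)) : p ∈ nodes 𝒯 T := by
  refine ⟨hpT, ?_⟩
  by_contra hlt
  -- With only two tiles at p, both angles are straight and p is a corner of neither. Both tiles
  -- then contain a piece of the separating line beyond p, contrary to p being an end of the
  -- intersection.
  have hpair : tilesAt 𝒯 p = {S, T} := by
    symm
    refine Set.eq_of_subset_of_ncard_le ?_ ?_ (h.finite_tilesAt p)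
    · rintro X (rfl | rfl)
      · exact ⟨hS, hpS⟩
      · exact ⟨hT, hpT⟩
    · rw [Set.ncard_pair hST]
      omega
  have hpiS := h.notMem_interior hT hS hST.symm hpT
  have hpiT := h.notMem_interior hS hT hST hpS
  have h1 := h.innerAngle_add_outerAngle hS hpS hpiS
  have h2 := h.innerAngle_add_outerAngle hT hpT hpiT
  have hE : (h.finite_tilesAt p).toFinset = {S, T} := by
    ext X
    rw [Set.Finite.mem_toFinset, hpair]
    simp
  have h3 := h.sum_innerAngle p
  rw [hE, Finset.sum_pair hST] at h3
  have h4 := outerAngle_nonneg S p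
  have h5 := outerAngle_nonneg T p
  have hS' : p ∉ Set.extremePoints ℝ S := fun hp => by
    linarith [(h.solid S hS).outerAngle_pos hp]
  have hT' : p ∉ Set.extremePoints ℝ T := fun hp => by
    linarith [(h.solid T hT).outerAngle_pos hp]
  obtain ⟨a, ha, b, hb, hab, hpab⟩ := IsSolidPolygon.exists_openSegment hpS hS'
  obtain ⟨c, hc, d, hd, hcd, hpcd⟩ := IsSolidPolygon.exists_openSegment hpT hT'
  obtain ⟨w, hw, hwS, hwT⟩ := h.exists_separating hS hT hST hpS hpT
  have hwq : inner ℝ w (-(q - p)) = 0 := by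
    have h6 := hwS q hqS
    have h7 := hwT q hqT
    rw [inner_neg_left] at h7
    rw [inner_neg_right]
    linarith
  obtain ⟨s, hs, hsS⟩ := mem_tangentCone_of_openSegment ha hb hab hpab hpS hw hwS hwq
  obtain ⟨t, ht, htT⟩ := mem_tangentCone_of_openSegment hc hd hcd hpcd hpT (neg_ne_zero.2 hw) hwT
    (v := -(q - p)) (by rw [inner_neg_left, hwq, neg_zero])
  have hm : 0 < min s t := lt_min hs ht
  have h6 := hmin _ (add_smul_mem_of_le (h.solid S hS).convex hpS hsS hm.le (min_le_left _ _) hs)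
    (add_smul_mem_of_le (h.solid T hT).convex hpT htT hm.le (min_le_right _ _) ht)
  rw [add_sub_cancel_left, inner_smul_right, inner_neg_right, real_inner_self_eq_norm_sq] at h6
  have h7 : 0 < ‖q - p‖ := norm_pos_iff.2 (sub_ne_zero.2 hpq)
  have := mul_pos hm (pow_pos h7 2)
  linarith

/-- The first endpoint of an edge of `T`, when `T` lies to the left of the edge. -/
lemma exists_first_endpoint (h : IsPolygonTiling 𝒯 u U) (hTS : Adjacent 𝒯 T S) :
    ∃ p ∈ nodes 𝒯 T, p ∈ S ∧ ∃ q ∈ S, q ∈ T ∧ q ≠ p ∧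
      ∀ x ∈ T, 0 ≤ inner ℝ (quarterTurn (q - p)) (x - p) := by
  obtain ⟨hT, hS, hne, E, ⟨-, -, -, -, -, -, a, b, hab, rfl⟩, hET, hES⟩ := hTS
  have haT := hET (left_mem_segment ℝ a b)
  have hbT := hET (right_mem_segment ℝ a b)
  have haS := hES (left_mem_segment ℝ a b)
  have hbS := hES (right_mem_segment ℝ a b)
  obtain ⟨w, hw, hwT, hwS⟩ := h.exists_separating hT hS hne haT haS
  -- As w points out of `T`, its quarter turn is the direction along the edge that keeps `T` on the
  -- left; p is where the edge starts.
  obtain ⟨p, ⟨hpS, hpT⟩, hpmin⟩ := ((h.solid S hS).isCompact.inter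
    (h.solid T hT).isCompact).exists_isMinOn (f := fun x => inner ℝ (quarterTurn w) x) ⟨a, haS, haT⟩
    (by fun_prop)
  obtain ⟨q, hqS, hqT, hqp⟩ : ∃ q ∈ S, q ∈ T ∧ q ≠ p := by
    by_cases hpa : a = p
    · exact ⟨b, hbS, hbT, fun hb => hab (hpa.trans hb.symm)⟩
    · exact ⟨a, haS, haT, hpa⟩
  have hline : ∀ x ∈ S, x ∈ T → inner ℝ w (x - p) = 0 := by
    have key : ∀ x ∈ S, x ∈ T → inner ℝ w (x - a) = 0 := by
      intro x hxS hxT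
      have h1 := hwS x hxS
      rw [inner_neg_left] at h1
      linarith [hwT x hxT]
    intro x hxS hxT
    rw [← sub_sub_sub_cancel_right x p a, inner_sub_right, key x hxS hxT, key p hpS hpT, sub_zero]
  obtain ⟨k, hk⟩ := exists_smul_quarterTurn_of_inner_eq_zero hw (hline q hqS hqT)
  have hk0 : k ≠ 0 := by
    rintro rfl
    rw [zero_smul, sub_eq_zero] at hk
    exact hqp hk
  have hmin : ∀ x ∈ S, x ∈ T → 0 ≤ inner ℝ (quarterTurn w) (x - p) := by
    intro x hxS hxT
    rw [inner_sub_right]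
    exact sub_nonneg.2 (hpmin ⟨hxS, hxT⟩)
  have hkpos : 0 < k := by
    have h1 := hmin q hqS hqT
    rw [hk, inner_smul_right, real_inner_self_eq_norm_sq, quarterTurn.norm_map] at h1
    have h2 : 0 < ‖w‖ ^ 2 := pow_pos (norm_pos_iff.2 hw) 2
    exact lt_of_le_of_ne (nonneg_of_mul_nonneg_left h1 h2) hk0.symm
  refine ⟨p, ?_, hpS, q, hqS, hqT, hqp, ?_⟩
  · refine h.mem_nodes_of_endpoint hS hT hne.symm hpS hpT hqS hqT hqp fun x hxS hxT => ?_
    rw [hk, inner_smul_left]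
    exact mul_nonneg hkpos.le (hmin x hxS hxT)
  · intro x hxT
    rw [hk, map_smul, quarterTurn_quarterTurn, inner_smul_left, inner_neg_left]
    have h1 := hwT x hxT
    have h2 := hwT p hpT
    have h3 := hwS p hpS
    rw [inner_neg_left] at h3
    rw [← sub_sub_sub_cancel_right x p a, inner_sub_right]
    exact mul_nonneg hkpos.le (by linarith)

/-- A tile has at most as many adjacents as nodes. -/
theorem numAdjacents_le (h : IsPolygonTiling 𝒯 u U) (T : Set Plane) :
    numAdjacents 𝒯 T ≤ (nodes 𝒯 T).encard := by
  choose! f hf hfS g hgS hgT hgf hg using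
    fun S (hS : Adjacent 𝒯 T S) => h.exists_first_endpoint hS
  refine Set.encard_le_encard_of_injOn (f := f) (fun S hS => hf S hS) ?_
  intro S hS R hR hSR
  have hT : T ∈ 𝒯 := hS.1
  have hS' : Adjacent 𝒯 T S := hS
  have hR' : Adjacent 𝒯 T R := hR
  by_contra hne
  have hd : g S - f S ≠ 0 := sub_ne_zero.2 (hgf S hS)
  -- If two edges start at the same point, each has the end of the other weakly on its left, so they
  -- are collinear. Opposite directions would leave `T` without interior; equal directions would
  -- give three tiles a common segment.
  have h1 := hg S hS (g R) (hgT R hR)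
  have h2 := hg R hR (g S) (hgT S hS)
  rw [← hSR] at h2
  have hanti : ∀ x y : Plane, inner ℝ (quarterTurn x) y = -inner ℝ (quarterTurn y) x := by
    intro x y
    rw [inner_eq, inner_eq]
    simp only [quarterTurn_zero, quarterTurn_one]
    ring
  rw [hanti] at h2
  obtain ⟨k, hk⟩ := exists_smul_eq_of_inner_quarterTurn_eq_zero hd
    (show inner ℝ (quarterTurn (g S - f S)) (g R - f S) = 0 by linarith)
  have hgR : g R - f S ≠ 0 := by
    rw [hSR]; exact sub_ne_zero.2 (hgf R hR)
  have hpT : f S ∈ T := (hf S hS).1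
  rcases lt_trichotomy k 0 with hk0 | hk0 | hk0
  · obtain ⟨x, hx⟩ := (h.solid T hT).interior_nonempty
    have h3 := hg R hR
    rw [← hSR, hk] at h3
    have h4 := inner_neg_of_mem_interior (p := f S) (S := T) (w := quarterTurn (g S - f S))
      ((map_ne_zero_iff quarterTurn quarterTurn.injective).2 hd) (fun y hy => by
        have h5 := h3 y hy
        rw [map_smul, inner_smul_left] at h5
        change 0 ≤ k * _ at h5
        nlinarith) hx
    linarith [hg S hS x (interior_subset hx)]
  · rw [hk0, zero_smul] at hk
    exact hgR hk
  · have hm : 0 < min 1 k := lt_min one_pos hk0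
    have e1 : f S + (1 : ℝ) • (g S - f S) = g S := by simp
    have e2 : f S + k • (g S - f S) = g R := by rw [← hk]; simp
    have hfR : f S ∈ R := by rw [hSR]; exact hfS R hR
    have hcS := (h.solid S hS'.2.1).convex
    have hcR := (h.solid R hR'.2.1).convex
    have hcT := (h.solid T hT).convex
    have mS := add_smul_mem_of_le hcS (hfS S hS) (by rw [e1]; exact hgS S hS) hm.le
      (min_le_left 1 k) one_pos
    have mT := add_smul_mem_of_le hcT hpT (by rw [e1]; exact hgT S hS) hm.le
      (min_le_left 1 k) one_pos
    have mR := add_smul_mem_of_le hcR hfR (by rw [e2]; exact hgS R hR) hm.le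
      (min_le_right 1 k) hk0
    have := h.eq_of_mem_three hS'.2.1 hR'.2.1 hT hne hS'.2.2.1.symm hR'.2.2.1.symm
      ⟨hfS S hS, hfR, hpT⟩ ⟨mS, mR, mT⟩
    rw [left_eq_add, smul_eq_zero] at this
    exact this.elim hm.ne' hd

end IsPolygonTiling

/-! ### Discharging -/

namespace IsPolygonTiling

variable {𝒯 : Set (Set Plane)} {u U : ℝ} {T : Set Plane}

lemma sum_angle_excess (h : IsPolygonTiling 𝒯 u U) (hT : T ∈ 𝒯) {F : Finset Plane}
    (hF : ∀ p, p ∈ F ↔ p ∈ nodes 𝒯 T) :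
    ∑ p ∈ F, (diskArea / 3 - innerAngle T p) = diskArea - F.card * (diskArea / 6) := by
  have hF' : F = (h.finite_nodes hT).1.toFinset := by
    ext p
    rw [hF, Set.Finite.mem_toFinset]
  have := h.sum_nodes hT
  rw [← hF'] at this
  rw [Finset.sum_sub_distrib, Finset.sum_const, nsmul_eq_mul] at this ⊢
  linarith

/-- Discharging: up to a boundary term, a finite set of tiles has at most six nodes per tile. -/
theorem sum_ncard_nodes_le (h : IsPolygonTiling 𝒯 u U) {A B : Finset (Set Plane)}
    (hA : ∀ T ∈ A, T ∈ 𝒯) (hBA : B ⊆ A) {K : ℝ} (hK : ∀ T ∈ 𝒯, ((nodes 𝒯 T).ncard : ℝ) ≤ K)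
    (hAB : ∀ T ∈ A, T ∉ B → ∀ S ∈ 𝒯, (S ∩ T).Nonempty → S ∈ A) :
    ∑ T ∈ A, ((nodes 𝒯 T).ncard : ℝ) ≤ 6 * A.card + K * B.card := by
  classical
  have hex : ∀ T, ∃ F : Finset Plane, T ∈ 𝒯 → ∀ p, p ∈ F ↔ p ∈ nodes 𝒯 T := by
    intro T
    by_cases hT : T ∈ 𝒯
    · exact ⟨(h.finite_nodes hT).1.toFinset, fun _ p => Set.Finite.mem_toFinset _⟩
    · exact ⟨∅, fun h => absurd h hT⟩
  choose F hF using hex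
  have hcard : ∀ T ∈ 𝒯, (nodes 𝒯 T).ncard = (F T).card := by
    intro T hT
    rw [← Set.ncard_coe_finset]
    congr 1
    ext p
    exact (hF T hT p).symm
  set V := A.biUnion F
  have hω := diskArea_pos
  have hswap : ∑ T ∈ A, ∑ p ∈ F T, (diskArea / 3 - innerAngle T p) =
      ∑ p ∈ V, ∑ T ∈ A with p ∈ F T, (diskArea / 3 - innerAngle T p) := by
    refine Finset.sum_comm' fun T p => ?_
    simp only [V, Finset.mem_filter, Finset.mem_biUnion]
    exact ⟨fun ⟨h1, h2⟩ => ⟨⟨h1, h2⟩, T, h1, h2⟩, fun ⟨h1, _⟩ => h1⟩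
  have hswapB : ∑ T ∈ B, ∑ p ∈ F T, (1 : ℝ) = ∑ p ∈ V, ∑ T ∈ B with p ∈ F T, (1 : ℝ) := by
    refine Finset.sum_comm' fun T p => ?_
    simp only [V, Finset.mem_filter, Finset.mem_biUnion]
    exact ⟨fun ⟨h1, h2⟩ => ⟨⟨h1, h2⟩, T, hBA h1, h2⟩, fun ⟨h1, _⟩ => h1⟩
  -- If all tiles at p belong to `A`, the right side is at least 3 · ω/3 - ω = 0. Otherwise every
  -- tile of `A` at p is in `B`, and each term is at least ω/3 - ω/2 = -ω/6.
  have hpoint : ∀ p ∈ V, -(diskArea / 6) * ∑ T ∈ B with p ∈ F T, (1 : ℝ) ≤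
      ∑ T ∈ A with p ∈ F T, (diskArea / 3 - innerAngle T p) := by
    intro p hp
    obtain ⟨T₀, hT₀, hpT₀⟩ := Finset.mem_biUnion.1 hp
    have hp3 : 3 ≤ (tilesAt 𝒯 p).ncard := ((hF T₀ (hA T₀ hT₀) p).1 hpT₀).2
    have hmem : ∀ T ∈ 𝒯, (p ∈ F T ↔ p ∈ T) := fun T hT => by
      rw [hF T hT]
      exact ⟨fun h => h.1, fun h => ⟨h, hp3⟩⟩
    by_cases hall : tilesAt 𝒯 p ⊆ A
    · have hE : A.filter (fun T => p ∈ F T) = (h.finite_tilesAt p).toFinset := by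
        ext T
        rw [Set.Finite.mem_toFinset, Finset.mem_filter]
        constructor
        · rintro ⟨h1, h2⟩
          exact ⟨hA T h1, (hmem T (hA T h1)).1 h2⟩
        · intro h1
          exact ⟨hall h1, (hmem T h1.1).2 h1.2⟩
      have hc : ∑ T ∈ (h.finite_tilesAt p).toFinset, diskArea / 3 =
          (tilesAt 𝒯 p).ncard * (diskArea / 3) := by
        rw [Finset.sum_const, nsmul_eq_mul, Set.ncard_eq_toFinset_card _ (h.finite_tilesAt p)]
      rw [hE, Finset.sum_sub_distrib, h.sum_innerAngle p, hc]
      have h3 : (3 : ℝ) ≤ (tilesAt 𝒯 p).ncard := by exact_mod_cast hp3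
      have h0 : 0 ≤ ∑ T ∈ B with p ∈ F T, (1 : ℝ) := Finset.sum_nonneg fun _ _ => zero_le_one
      nlinarith
    · obtain ⟨S, hS, hSA⟩ := Set.not_subset.1 hall
      have hAB' : A.filter (fun T => p ∈ F T) = B.filter (fun T => p ∈ F T) := by
        refine Finset.Subset.antisymm (fun T hT => ?_) (Finset.filter_subset_filter _ hBA)
        rw [Finset.mem_filter] at hT ⊢
        refine ⟨?_, hT.2⟩
        by_contra hTB
        exact hSA (hAB T hT.1 hTB S hS.1 ⟨p, hS.2, (hmem T (hA T hT.1)).1 hT.2⟩)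
      rw [hAB', Finset.mul_sum]
      refine Finset.sum_le_sum fun T hT => ?_
      rw [Finset.mem_filter] at hT
      have hT𝒯 := hA T (hBA hT.1)
      have hn := (hF T hT𝒯 p).1 hT.2
      linarith [h.innerAngle_le hT𝒯 hn.1 (h.notMem_interior_of_mem_nodes hT𝒯 hn)]
  have h1 := Finset.sum_le_sum hpoint
  rw [← hswap, ← Finset.mul_sum, ← hswapB,
    Finset.sum_congr rfl fun T hT => h.sum_angle_excess (hA T hT) (hF T (hA T hT)),
    Finset.sum_sub_distrib, ← Finset.sum_mul, Finset.sum_const, nsmul_eq_mul] at h1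
  have h2 : ∑ T ∈ B, ∑ p ∈ F T, (1 : ℝ) ≤ B.card * K := by
    rw [← nsmul_eq_mul]
    refine Finset.sum_le_card_nsmul _ _ _ fun T hT => ?_
    rw [Finset.sum_const, nsmul_eq_mul, mul_one, ← hcard T (hA T (hBA hT))]
    exact hK T (hA T (hBA hT))
  rw [Finset.sum_congr rfl fun T hT => by rw [hcard T (hA T hT)]]
  have h3 : (∑ T ∈ A, ((F T).card : ℝ) - 6 * A.card - K * B.card) * (diskArea / 6) ≤ 0 := by
    nlinarith
  nlinarith [nonpos_of_mul_nonpos_left h3 (by positivity)]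

end IsPolygonTiling

/-! ### Patches: size and rim -/

namespace IsPolygonTiling

variable {𝒯 : Set (Set Plane)} {u U : ℝ} {T : Set Plane}

lemma patch_subset (𝒯 : Set (Set Plane)) (r : ℝ) (M : Plane) : patch 𝒯 r M ⊆ 𝒯 := by
  rintro T ((hT | hT) | hT) <;> exact hT.1

lemma subset_closedBall_of_mem_boundaryTiles (h : IsPolygonTiling 𝒯 u U) {r : ℝ} {M : Plane}
    (hT : T ∈ boundaryTiles 𝒯 r M) : T ⊆ closedBall M (r + 2 * U) := by
  obtain ⟨hT, ⟨x, hx, hxM⟩, -⟩ := hT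
  refine (h.subset_closedBall hT hx).trans (closedBall_subset_closedBall' ?_)
  rw [mem_sphere.1 hxM]
  linarith

/-- For a surrounded tile: from an interior point farther than r + 2U from M, the ray leading away
from M meets no boundary tile, so the component would be unbounded. -/
lemma subset_closedBall_of_mem_patch (h : IsPolygonTiling 𝒯 u U) {r : ℝ} (hr : 0 < r) {M : Plane}
    (hT : T ∈ patch 𝒯 r M) : T ⊆ closedBall M (r + 2 * U) := by
  have hU := h.U_pos
  rcases hT with (hT | hT) | hT
  · exact hT.2.trans (closedBall_subset_closedBall (by linarith))
  · exact h.subset_closedBall_of_mem_boundaryTiles hT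
  · obtain ⟨hT, -, x, -, hbdd, hint⟩ := hT
    refine (h.subset_closure_interior hT).trans (closure_minimal ?_ isClosed_closedBall)
    intro y hy
    by_contra hyM
    rw [mem_closedBall, not_le, dist_eq_norm] at hyM
    set C := (⋃₀ boundaryTiles 𝒯 r M)ᶜ
    set ray : Set Plane := (fun s : ℝ => M + s • (y - M)) '' Ici 1
    have hnorm : ∀ s : ℝ, 1 ≤ s → dist (M + s • (y - M)) M = s * ‖y - M‖ := fun s hs => by
      rw [dist_self_add_left, norm_smul, Real.norm_of_nonneg (by linarith)]
    have hrayC : ray ⊆ C := by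
      rintro _ ⟨s, hs, rfl⟩ ⟨S, hS, hmem⟩
      have h1 := mem_closedBall.1 (h.subset_closedBall_of_mem_boundaryTiles hS hmem)
      have hs' : 1 ≤ s := hs
      rw [hnorm s hs'] at h1
      nlinarith
    have hray : IsPreconnected ray :=
      isPreconnected_Ici.image _ (by fun_prop)
    have hyray : y ∈ ray := ⟨1, self_mem_Ici, by simp⟩
    have hsub : ray ⊆ connectedComponentIn C x := by
      rw [connectedComponentIn_eq (hint hy)]
      exact hray.subset_connectedComponentIn hyray hrayC
    obtain ⟨ρ, hρ⟩ := (hbdd.subset hsub).subset_closedBall M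
    have hpos : 0 < ‖y - M‖ := by linarith
    have hs : (1 : ℝ) ≤ max 1 ((ρ + 1) / ‖y - M‖) := le_max_left _ _
    have h2 := mem_closedBall.1 (hρ ⟨_, hs, rfl⟩)
    change dist (M + _ • (y - M)) M ≤ ρ at h2
    rw [hnorm _ hs] at h2
    have h3 : ρ + 1 ≤ max 1 ((ρ + 1) / ‖y - M‖) * ‖y - M‖ := by
      rw [← div_le_iff₀ hpos]
      exact le_max_right _ _
    linarith

lemma finite_patch (h : IsPolygonTiling 𝒯 u U) {r : ℝ} (hr : 0 < r) (M : Plane) :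
    (patch 𝒯 r M).Finite :=
  (h.finite_subset (R := closedBall M (r + 2 * U)) measure_closedBall_lt_top.ne).subset
    fun _ hT => ⟨patch_subset _ _ _ hT, h.subset_closedBall_of_mem_patch hr hT⟩

lemma mem_patch_of_mem_closedBall (h : IsPolygonTiling 𝒯 u U) {r : ℝ} {M x : Plane}
    (hT : T ∈ 𝒯) (hx : x ∈ T) (hxM : x ∈ closedBall M r) : T ∈ patch 𝒯 r M := by
  by_cases hsub : T ⊆ closedBall M r
  · exact Or.inl (Or.inl ⟨hT, hsub⟩)
  · obtain ⟨y, hy, hyM⟩ := Set.not_subset.1 hsub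
    rw [mem_closedBall] at hxM
    rw [mem_closedBall, not_le] at hyM
    obtain ⟨z, hz, hzM⟩ := (h.solid T hT).convex.isPreconnected.intermediate_value hx hy
      (f := fun z => dist z M) (by fun_prop) ⟨hxM, hyM.le⟩
    exact Or.inl (Or.inr ⟨hT, ⟨z, hz, hzM⟩, hsub⟩)

lemma sq_le_card_patch (h : IsPolygonTiling 𝒯 u U) {r : ℝ} (hr : 0 < r) (M : Plane) :
    r ^ 2 ≤ U ^ 2 * (patch 𝒯 r M).ncard := by
  have hfin := h.finite_patch hr M
  have hcover : closedBall M r ⊆ ⋃ T ∈ hfin.toFinset, T := by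
    intro x hx
    obtain ⟨T, hT, hxT⟩ := h.exists_mem x
    simp only [mem_iUnion, Set.Finite.mem_toFinset]
    exact ⟨T, h.mem_patch_of_mem_closedBall hT hxT hx, hxT⟩
  have htop : volume (⋃ T ∈ hfin.toFinset, T) ≠ ⊤ := by
    refine (measure_biUnion_lt_top hfin.toFinset.finite_toSet fun T hT => ?_).ne
    exact (h.volume_ne_top (patch_subset _ _ _ (hfin.mem_toFinset.1 hT))).lt_top
  have h1 := (measureReal_mono hcover htop).trans (measureReal_biUnion_finset_le _ _)
  have h2 : ∑ T ∈ hfin.toFinset, volume.real T ≤ hfin.toFinset.card • (U ^ 2 * diskArea) := by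
    refine Finset.sum_le_card_nsmul _ _ _ fun T hT => ?_
    obtain ⟨y, hy⟩ := h.exists_subset_closedBall T (patch_subset _ _ _ (hfin.mem_toFinset.1 hT))
    rw [← volume_real_closedBall y h.U_pos.le]
    exact measureReal_mono hy measure_closedBall_lt_top.ne
  rw [volume_real_closedBall M hr.le] at h1
  rw [Set.ncard_eq_toFinset_card _ hfin]
  rw [nsmul_eq_mul, ← mul_assoc] at h2
  linarith [le_of_mul_le_mul_right (h1.trans h2) diskArea_pos]

lemma exists_sum_ncard_nodes_patch_le (h : IsPolygonTiling 𝒯 u U) :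
    ∃ C, ∀ (M : Plane) (r : ℝ) (hr : 0 < r), 2 * U ≤ r →
      ∑ T ∈ (h.finite_patch hr M).toFinset, ((nodes 𝒯 T).ncard : ℝ) ≤
        6 * (patch 𝒯 r M).ncard + C * r := by
  classical
  have hU := h.U_pos
  -- The first factor bounds the nodes of a tile. The second is the area 8Urω of the annulus between
  -- the radii r ± 2U, divided by u²ω and by r.
  refine ⟨(16 * U ^ 2 / u ^ 2) ^ 2 * (8 * U / u ^ 2), fun M r hr hrU => ?_⟩
  have hfin := h.finite_patch hr M
  set A := hfin.toFinset
  set R : Set Plane := closedBall M (r + 2 * U) \ closedBall M (r - 2 * U)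
  set B := A.filter (fun T => T ⊆ R)
  -- A tile outside the patch has no point in the disk of radius r, so a patch tile touching it
  -- stays beyond radius r - 2U.
  have hAB : ∀ T ∈ A, T ∉ B → ∀ S ∈ 𝒯, (S ∩ T).Nonempty → S ∈ A := by
    rintro T hT hTB S hS ⟨z, hzS, hzT⟩
    by_contra hSA
    rw [Set.Finite.mem_toFinset] at hT hSA
    refine hTB (Finset.mem_filter.2 ⟨hfin.mem_toFinset.2 hT, fun x hx => ?_⟩)
    refine ⟨h.subset_closedBall_of_mem_patch hr hT hx, fun hxM => ?_⟩
    refine hSA (h.mem_patch_of_mem_closedBall hS hzS ?_)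
    have h1 := mem_closedBall.1 (h.subset_closedBall (patch_subset _ _ _ hT) hx hzT)
    rw [mem_closedBall] at hxM ⊢
    linarith [dist_triangle z x M]
  have hRfin : volume R ≠ ⊤ := measure_ne_top_of_subset sdiff_subset measure_closedBall_lt_top.ne
  have hB := h.card_mul_le hRfin B fun T hT => by
    rw [Finset.mem_filter, Set.Finite.mem_toFinset] at hT
    exact ⟨patch_subset _ _ _ hT.1, hT.2⟩
  have hR : volume.real R = 8 * U * r * diskArea := by
    rw [measureReal_sdiff (closedBall_subset_closedBall (by linarith))
      measurableSet_closedBall measure_closedBall_lt_top.ne, volume_real_closedBall _ (by linarith),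
      volume_real_closedBall _ (by linarith)]
    ring
  rw [hR, ← mul_assoc] at hB
  replace hB := le_of_mul_le_mul_right hB diskArea_pos
  have hB' : (B.card : ℝ) ≤ 8 * U / u ^ 2 * r := by
    rw [div_mul_eq_mul_div, le_div_iff₀ (pow_pos h.u_pos 2)]
    exact hB
  have h1 := h.sum_ncard_nodes_le (A := A) (B := B)
    (fun T hT => patch_subset _ _ _ (hfin.mem_toFinset.1 hT)) (Finset.filter_subset _ _)
    (fun T hT => (h.finite_nodes hT).2) hAB
  rw [Set.ncard_eq_toFinset_card _ hfin]
  refine h1.trans ?_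
  rw [mul_assoc]
  gcongr

end IsPolygonTiling

/-! ### Convex n-gons as solid polygons -/

section NGon

variable {n : ℕ} {P : Set Plane}

lemma IsConvexNGon.isSolidPolygon (hP : IsConvexNGon n P) (hi : (interior P).Nonempty) :
    IsSolidPolygon P := by
  obtain ⟨-, c, -, rfl⟩ := hP
  exact ⟨convex_convexHull _ _, (finite_range c).isCompact_convexHull ℝ, hi,
    (finite_range c).subset extremePoints_convexHull_subset⟩

/-- Otherwise the corners are collinear, and among three of them one lies between the other two. -/
lemma IsConvexNGon.interior_nonempty (hP : IsConvexNGon n P) : (interior P).Nonempty := by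
  obtain ⟨hn, c, hc, rfl⟩ := hP
  rw [interior_convexHull_nonempty_iff_affineSpan_eq_top]
  by_contra hspan
  have hcol : Collinear ℝ (range c) := by
    rw [collinear_iff_finrank_le_one]
    have hlt : Module.finrank ℝ (vectorSpan ℝ (range c)) < Module.finrank ℝ Plane := by
      refine Submodule.finrank_lt fun htop => hspan ?_
      have hne : (range c).Nonempty := ⟨c ⟨0, by omega⟩, mem_range_self _⟩
      rwa [AffineSubspace.affineSpan_eq_top_iff_vectorSpan_eq_top_of_nonempty _ _ _ hne]
    rw [finrank_euclideanSpace_fin] at hlt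
    omega
  have hwbtw : ∀ i j k : Fin n, i ≠ j → k ≠ j → ¬ Wbtw ℝ (c i) (c j) (c k) := by
    intro i j k hij hkj hw
    have h1 : c j ∈ convexHull ℝ (c '' {i, k}) := by
      rw [image_pair, convexHull_pair]
      exact mem_segment_iff_wbtw.2 hw
    rcases hc {i, k} j h1 with h2 | h2
    · exact hij h2.symm
    · exact hkj h2.symm
  have h3 : Collinear ℝ {c ⟨0, by omega⟩, c ⟨1, by omega⟩, c ⟨2, by omega⟩} :=
    hcol.subset (by rintro _ (rfl | rfl | rfl) <;> exact mem_range_self _)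
  rcases h3.wbtw_or_wbtw_or_wbtw with h | h | h
  · exact hwbtw _ _ _ (by simp) (by simp) h
  · exact hwbtw _ _ _ (by simp) (by simp) h
  · exact hwbtw _ _ _ (by simp) (by simp) h

/-- If some `c i` were not extreme, all extreme points would be among the other corners, whose hull
would then contain `c i`. -/
lemma IsConvexNGon.le_ncard_extremePoints (hP : IsConvexNGon n P) :
    n ≤ (Set.extremePoints ℝ P).ncard := by
  have hsolid := hP.isSolidPolygon hP.interior_nonempty
  obtain ⟨-, c, hc, rfl⟩ := hP
  have hmem : ∀ i, c i ∈ Set.extremePoints ℝ (convexHull ℝ (range c)) := by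
    intro i
    by_contra hi
    have hsub : Set.extremePoints ℝ (convexHull ℝ (range c)) ⊆ c '' {i}ᶜ := by
      intro x hx
      obtain ⟨j, rfl⟩ := extremePoints_convexHull_subset hx
      refine ⟨j, ?_, rfl⟩
      rintro rfl
      exact hi hx
    have h1 : c i ∈ convexHull ℝ (c '' {i}ᶜ) :=
      convexHull_mono hsub (hsolid.convexHull_extremePoints.symm ▸
        subset_convexHull ℝ _ (mem_range_self i))
    exact hc _ _ h1 rfl
  have h1 := Set.ncard_le_ncard (range_subset_iff.2 hmem) hsolid.finite_corners
  have hcard : (range c).ncard = n := by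
    rw [← image_univ, Set.ncard_image_of_injective _ hc.injective, Set.ncard_univ,
      Nat.card_eq_fintype_card, Fintype.card_fin]
  rwa [hcard] at h1

lemma IsConvexNGon.image (hP : IsConvexNGon n P) (g : Plane ≃ᵢ Plane) :
    IsConvexNGon n (g '' P) := by
  obtain ⟨hn, c, hc, rfl⟩ := hP
  have hg : ∀ s : Set Plane, g '' convexHull ℝ s = convexHull ℝ (g '' s) := fun s =>
    g.toRealAffineIsometryEquiv.toAffineEquiv.toAffineMap.image_convexHull s
  refine ⟨hn, g ∘ c, fun s i hi => ?_, by rw [hg, range_comp]⟩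
  rw [image_comp, ← hg] at hi
  obtain ⟨y, hy, hyi⟩ := hi
  rw [Function.comp_apply, g.injective.eq_iff] at hyi
  exact hc s i (hyi ▸ hy)

end NGon

/-! ### Averages over large patches -/

/-- In a tiling by convex polygons containing a disk of radius `u` and contained in a disk of
radius `U`, the numbers of adjacents average at most six. -/
theorem IsPolygonTiling.sum_mul_density_le {𝒯 : Set (Set Plane)} {u U : ℝ}
    (h : IsPolygonTiling 𝒯 u U) (M : Plane) (t : ℕ → ℝ) (ht : ∀ k, IsTileDensity 𝒯 M k (t k)) :
    ∃ K : ℕ, (∀ k, K < k → t k = 0) ∧ ∑ k ∈ Finset.range (K + 1), (k : ℝ) * t k ≤ 6 := by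
  classical
  obtain ⟨C, hC⟩ := h.exists_sum_ncard_nodes_patch_le
  obtain ⟨K, hK⟩ := exists_nat_ge ((16 * U ^ 2 / u ^ 2) ^ 2)
  have hnodes : ∀ T ∈ 𝒯, (nodes 𝒯 T).ncard ≤ K := fun T hT => by
    exact_mod_cast (h.finite_nodes hT).2.trans hK
  have hadj : ∀ T ∈ 𝒯, ∀ k : ℕ, numAdjacents 𝒯 T = k → k ≤ (nodes 𝒯 T).ncard := by
    intro T hT k hk
    have := h.numAdjacents_le T
    rw [hk, ← (h.finite_nodes hT).1.cast_ncard_eq] at this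
    exact_mod_cast this
  refine ⟨K, fun k hk => ?_, ?_⟩
  · have hzero : ∀ r, tileCountWith 𝒯 k r M = 0 := by
      intro r
      rw [tileCountWith]
      convert Set.ncard_empty (Set Plane)
      refine eq_empty_of_forall_notMem fun T hT => ?_
      have hT𝒯 := patch_subset _ _ _ hT.1
      have := (hadj T hT𝒯 k hT.2).trans (hnodes T hT𝒯)
      omega
    refine tendsto_nhds_unique (ht k) ?_
    simp [hzero]
  · have hpt : ∀ r : ℝ, 0 < r → 2 * U ≤ r →
        ∑ k ∈ Finset.range (K + 1),
          (k : ℝ) * ((tileCountWith 𝒯 k r M : ℝ) / (tileCount 𝒯 r M : ℝ)) ≤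
            6 + |C| * U ^ 2 / r := by
      intro r hr hrU
      have hfin := h.finite_patch hr M
      set A := hfin.toFinset
      have hA : ∀ T, T ∈ A ↔ T ∈ patch 𝒯 r M := fun T => hfin.mem_toFinset
      have hcount : ∀ k : ℕ, (tileCountWith 𝒯 k r M : ℝ) =
          ∑ T ∈ A, if numAdjacents 𝒯 T = k then (1 : ℝ) else 0 := by
        intro k
        rw [Finset.sum_boole, tileCountWith, ← Set.ncard_coe_finset]
        congr 3
        ext T
        simp [hA]
      have hsum : ∑ k ∈ Finset.range (K + 1), (k : ℝ) * (tileCountWith 𝒯 k r M : ℝ) ≤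
          ∑ T ∈ A, ((nodes 𝒯 T).ncard : ℝ) := by
        simp only [hcount, Finset.mul_sum]
        rw [Finset.sum_comm]
        refine Finset.sum_le_sum fun T hT => ?_
        have hT𝒯 := patch_subset _ _ _ ((hA T).1 hT)
        by_cases hex : ∃ m : ℕ, numAdjacents 𝒯 T = m
        · obtain ⟨m, hm⟩ := hex
          have hmn := hadj T hT𝒯 m hm
          have hle : (m : ℝ) ≤ (nodes 𝒯 T).ncard := by exact_mod_cast hmn
          simp only [hm, Nat.cast_inj, mul_ite, mul_one, mul_zero, Finset.sum_ite_eq]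
          split_ifs
          · exact hle
          · positivity
        · push Not at hex
          simp [hex]
      have hpos : 0 < r ^ 2 := by positivity
      have hsq := h.sq_le_card_patch hr M
      have hU2 : 0 < U ^ 2 := pow_pos h.U_pos 2
      have htc : (0 : ℝ) < tileCount 𝒯 r M := by
        rw [tileCount]
        by_contra hneg
        nlinarith
      simp only [← mul_div_assoc]
      rw [← Finset.sum_div, div_le_iff₀ htc]
      have h1 := hsum.trans (hC M r hr hrU)
      -- The inequality r² ≤ U² · `tileCount` turns the rim term into O(1/r) per tile.
      have h2 : C * r ≤ |C| * U ^ 2 / r * tileCount 𝒯 r M := by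
        have h3 : |C| * r ≤ |C| * U ^ 2 / r * tileCount 𝒯 r M := by
          rw [div_mul_eq_mul_div, le_div_iff₀ hr]
          have := mul_le_mul_of_nonneg_left hsq (abs_nonneg C)
          rw [tileCount]
          linarith
        exact (mul_le_mul_of_nonneg_right (le_abs_self C) hr.le).trans h3
      rw [tileCount] at h2 ⊢
      linarith
    have hlim1 : Tendsto (fun r : ℝ => ∑ k ∈ Finset.range (K + 1),
        (k : ℝ) * ((tileCountWith 𝒯 k r M : ℝ) / (tileCount 𝒯 r M : ℝ))) atTop
        (𝓝 (∑ k ∈ Finset.range (K + 1), (k : ℝ) * t k)) :=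
      tendsto_finsetSum _ fun k _ => (ht k).const_mul _
    have hlim2 : Tendsto (fun r : ℝ => 6 + |C| * U ^ 2 / r) atTop (𝓝 6) := by
      simpa using (tendsto_const_nhds (x := (6 : ℝ))).add
        (tendsto_const_nhds.div_atTop tendsto_id)
    refine le_of_tendsto_of_tendsto hlim1 hlim2 ?_
    filter_upwards [eventually_gt_atTop 0, eventually_ge_atTop (2 * U)] with r hr hrU
    exact hpt r hr hrU

/-- Not every tile has seven corners. -/
theorem IsPolygonTiling.le_six_of_forall_le_ncard_nodes {𝒯 : Set (Set Plane)} {u U : ℝ}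
    (h : IsPolygonTiling 𝒯 u U) {n : ℕ} (hn : ∀ T ∈ 𝒯, n ≤ (nodes 𝒯 T).ncard) : n ≤ 6 := by
  by_contra! hlt
  obtain ⟨C, hC⟩ := h.exists_sum_ncard_nodes_patch_le
  have hU2 : 0 < U ^ 2 := pow_pos h.U_pos 2
  -- With N tiles in the patch, 7N ≤ 6N + Cr gives N ≤ |C|r, and r² ≤ U²N then gives r ≤ |C|U²,
  -- which this choice excludes.
  set r : ℝ := max (2 * U) (|C| * U ^ 2 + 1)
  have hrU : 2 * U ≤ r := le_max_left _ _
  have hrC : |C| * U ^ 2 + 1 ≤ r := le_max_right _ _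
  have hr : 0 < r := lt_of_lt_of_le (by linarith [h.U_pos]) hrU
  have hfin := h.finite_patch hr 0
  have h1 := hC 0 r hr hrU
  have h2 : hfin.toFinset.card • (7 : ℝ) ≤ ∑ T ∈ hfin.toFinset, ((nodes 𝒯 T).ncard : ℝ) := by
    refine Finset.card_nsmul_le_sum _ _ _ fun T hT => ?_
    have := hn T (patch_subset _ _ _ (hfin.mem_toFinset.1 hT))
    exact_mod_cast (by omega : 7 ≤ (nodes 𝒯 T).ncard)
  rw [nsmul_eq_mul, ← Set.ncard_eq_toFinset_card _ hfin] at h2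
  have h3 := h.sq_le_card_patch hr 0
  have h4 : ((patch 𝒯 r 0).ncard : ℝ) ≤ |C| * r := by
    have := mul_le_mul_of_nonneg_right (le_abs_self C) hr.le
    linarith
  have h5 := mul_le_mul_of_nonneg_left h4 hU2.le
  nlinarith

end PlaneTiling

end

theorem proposition1 :
    (∀ 𝒯 : Set (Set PlaneTiling.Plane),
      PlaneTiling.IsTiling 𝒯 →
      (∀ T ∈ 𝒯, PlaneTiling.IsConvexPolygon T) →
      PlaneTiling.IsStronglyBalanced 𝒯 →
      ∀ (M : PlaneTiling.Plane) (t : ℕ → ℝ),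
        (∀ h : ℕ, PlaneTiling.IsTileDensity 𝒯 M h (t h)) →
        Summable (fun h : {h : ℕ // 3 ≤ h} => ((h : ℕ) : ℝ) * t h) ∧
          ∑' h : {h : ℕ // 3 ≤ h}, ((h : ℕ) : ℝ) * t h ≤ 6) ∧
    (∀ (n : ℕ) (P : Set PlaneTiling.Plane),
      PlaneTiling.IsConvexNGon n P →
      (∃ 𝒯 : Set (Set PlaneTiling.Plane),
        PlaneTiling.IsTiling 𝒯 ∧
        (∀ T ∈ 𝒯, PlaneTiling.IsCongruentTo P T) ∧
        PlaneTiling.IsPeriodic 𝒯) →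
      n ≤ 6) := by
  constructor
  · intro 𝒯 htil hpoly hbal M t ht
    obtain ⟨u, U, hu, hU, hb⟩ := hbal.1.2.2
    have h : PlaneTiling.IsPolygonTiling 𝒯 u U :=
      { isTiling := htil
        solid := fun T hT => by
          obtain ⟨n, hn⟩ := hpoly T hT
          exact hn.isSolidPolygon hn.interior_nonempty
        u_pos := hu
        U_pos := hU
        exists_closedBall_subset := fun T hT => (hb T hT).1
        exists_subset_closedBall := fun T hT => (hb T hT).2 }
    obtain ⟨K, hK, hsum⟩ := h.sum_mul_density_le M t ht
    have hnn : ∀ k : ℕ, 0 ≤ (k : ℝ) * t k := fun k =>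
      mul_nonneg k.cast_nonneg (ge_of_tendsto' (ht k) fun r => by positivity)
    have hs : HasSum (fun k : ℕ => (k : ℝ) * t k)
        (∑ k ∈ Finset.range (K + 1), (k : ℝ) * t k) :=
      hasSum_sum_of_ne_finset_zero fun k hk => by
        rw [hK k (by simpa [Nat.lt_succ_iff] using hk), mul_zero]
    refine ⟨hs.summable.comp_injective Subtype.val_injective, ?_⟩
    -- All terms are nonnegative, so leaving out h < 3 cannot increase the sum.
    refine (tsum_comp_le_tsum_of_inj hs.summable hnn Subtype.val_injective).trans ?_
    rw [hs.tsum_eq]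
    exact hsum
  · rintro n P hP ⟨𝒯, htil, hcong, -⟩
    obtain ⟨x, hx⟩ := hP.interior_nonempty
    obtain ⟨u, hu, hxu⟩ := Metric.nhds_basis_closedBall.mem_iff.1 (mem_interior_iff_mem_nhds.1 hx)
    obtain ⟨U, hPU⟩ :=
      (hP.isSolidPolygon hP.interior_nonempty).isCompact.isBounded.subset_closedBall x
    have hgon : ∀ T ∈ 𝒯, PlaneTiling.IsConvexNGon n T := by
      intro T hT
      obtain ⟨g, rfl⟩ := hcong T hT
      exact hP.image g
    -- Congruences carry one inscribed and one enclosing disk of `P` to every tile; the maximum with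
    -- 1 makes the outer radius positive.
    have h : PlaneTiling.IsPolygonTiling 𝒯 u (max U 1) :=
      { isTiling := htil
        solid := fun T hT => (hgon T hT).isSolidPolygon (hgon T hT).interior_nonempty
        u_pos := hu
        U_pos := lt_max_of_lt_right one_pos
        exists_closedBall_subset := fun T hT => by
          obtain ⟨g, rfl⟩ := hcong T hT
          refine ⟨g x, ?_⟩
          rw [← g.image_closedBall]
          exact Set.image_mono hxu
        exists_subset_closedBall := fun T hT => by
          obtain ⟨g, rfl⟩ := hcong T hT
          refine ⟨g x, ?_⟩
          rw [← g.image_closedBall]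
          exact Set.image_mono (hPU.trans (Metric.closedBall_subset_closedBall (le_max_left _ _))) }
    refine h.le_six_of_forall_le_ncard_nodes fun T hT => ?_
    exact (hgon T hT).le_ncard_extremePoints.trans
      (Set.ncard_le_ncard (h.extremePoints_subset_nodes hT) (h.finite_nodes hT).1)
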